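/- Let $E=(E^0,E^1,r,s)$ be a row-finite directed graph (every vertex emits only finitely many edges; $E^0$ and $E^1$ may be infinite) and let $\mathbb K$ be a field. The Leavitt path algebra $L_{\mathbb K}(E)$ is the associative, not necessarily unital, $\mathbb K$-algebra generated by the vertices $v\in E^0$, the edges $e\in E^1$ and the ghost edges $e^*$ ($e\in E^1$) with the relations $vw=\delta_{v,w}v$; $s(e)e=e\,r(e)=e$; $r(e)e^*=e^*s(e)=e^*$; $e^*f=\delta_{e,f}\,r(e)$; and $v=\sum_{s(e)=v}ee^*$ for every vertex $v$ with $0<|s^{-1}(v)|<\infty$. It is $\mathbb Z$-graded: the component of degree $n$ is spanned by the elements $\alpha\beta^*$ with $\alpha,\beta$ finite paths, $r(\alpha)=r(\beta)$ and $|\alpha|-|\beta|=n$. Assume that $L_{\mathbb K}(E)$ is graded simple (it is nonzero and has no graded two-sided ideals other than $0$ and itself) but not simple. Then: 1. $E$ is a comet: up to cyclic rotation $E$ has exactly one cycle $c$ (a cycle is a path $e_1\cdots e_n$, $n\ge 1$, with $r(e_n)=s(e_1)$ and $s(e_i)\ne s(e_j)$ for $i\neq j$); from every vertex of $E$ there is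 a path, possibly of length $0$, to a vertex of $c$; and every infinite path of $E$ ends in $c$, that is, from some index on it is $ccc\cdots$. 2. There is a nonempty, possibly infinite, set $\Lambda$ such that $L_{\mathbb K}(E)\cong M_\Lambda(\mathbb K[x,x^{-1}])$ as $\mathbb K$-algebras, where $M_\Lambda(R)$ denotes the algebra of $\Lambda\times\Lambda$ matrices over $R$ with only finitely many nonzero entries. 3. The centroid $\mathcal C(L_{\mathbb K}(E))$, that is, the algebra under composition of all $\mathbb K$-linear maps $\tau\colon L_{\mathbb K}(E)\to L_{\mathbb K}(E)$ with $\tau(xy)=\tau(x)y=x\tau(y)$ for all $x,y$, is isomorphic to $\mathbb K[x,x^{-1}]$ as a $\mathbb K$-algebra. -/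

import Mathlib

universe u v w

/-! ### Directed graphs -/

/-- A directed graph with vertex set `V` and edge set `E`: every edge `e` has a source `s e` and a
range `r e`. Loops, parallel edges and infinite vertex or edge sets are allowed. -/
structure DirectedGraph (V : Type u) (E : Type v) where
  s : E → V
  r : E → V

namespace DirectedGraph

variable {V : Type u} {E : Type v} (G : DirectedGraph V E)

/-- Every vertex emits only finitely many edges. -/
def RowFinite : Prop := ∀ v : V, {e : E | G.s e = v}.Finite

/-- `G.IsPath a p b`: the list of edges `p = e₁ ⋯ eₙ` is a finite path from `a` to `b`; the empty
list is the path of length `0` at a vertex. -/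
def IsPath : V → List E → V → Prop
  | a, [], b => a = b
  | a, e :: p, b => G.s e = a ∧ IsPath (G.r e) p b

/-- The relation `a ≥ b`: there is a finite path (possibly of length `0`) from `a` to `b`. -/
def Reaches (a b : V) : Prop := ∃ p : List E, G.IsPath a p b

/-- The tree `T(a)` of a vertex `a`. -/
def tree (a : V) : Set V := {b | G.Reaches a b}

/-- The set of vertices which are sources or ranges of the edges of a path. -/
def vertexSet (p : List E) : Set V := {a | ∃ e ∈ p, G.s e = a ∨ G.r e = a}

/-- A cycle is a path `e₁ ⋯ eₙ` of positive length with the same source and range such that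
`s(eᵢ) ≠ s(eⱼ)` for `i ≠ j`. -/
def IsCycle (c : List E) : Prop :=
  c ≠ [] ∧ (∃ a : V, G.IsPath a c a) ∧ (c.map G.s).Nodup

/-- An infinite path is an infinite sequence of edges with `r(fᵢ) = s(fᵢ₊₁)`. -/
def IsInfinitePath (f : ℕ → E) : Prop := ∀ i, G.r (f i) = G.s (f (i + 1))

/-- From some index on, the sequence of edges `f` is `p p p ⋯`. -/
def EndsIn (f : ℕ → E) (p : List E) : Prop :=
  ∃ N : ℕ, ∀ i : ℕ, p[i % p.length]? = some (f (N + i))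

/-- `G` is a comet: it has exactly one cycle `c` (as usual, a cycle is not distinguished from its
cyclic rotations, which run through the same edges from another starting vertex), the tree of
every vertex meets `c`, and every infinite path ends in `c`. -/
def IsComet : Prop :=
  ∃ c : List E, G.IsCycle c ∧ (∀ d : List E, G.IsCycle d → d ~r c) ∧
    (∀ a : V, (G.tree a ∩ G.vertexSet c).Nonempty) ∧
    ∀ f : ℕ → E, G.IsInfinitePath f → EndsIn f c

end DirectedGraph

/-! ### Leavitt path algebras -/

/-- Generators of the Leavitt path algebra: vertices, edges `e` and ghost edges `e*`. -/
inductive LeavittGen (V : Type u) (E : Type v) : Type (max u v)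
  | vertex (a : V)
  | edge (e : E)
  | ghost (e : E)

/-- The free associative (non-unital) `K`-algebra on vertices, edges and ghost edges: its `K`-basis
consists of the nonempty words in the generators. -/
abbrev FreeLeavitt (K : Type w) [CommRing K] (V : Type u) (E : Type v) : Type (max u v w) :=
  MonoidAlgebra K (FreeSemigroup (LeavittGen V E))

namespace LeavittPathAlgebra

noncomputable section

variable (K : Type w) [CommRing K] {V : Type u} {E : Type v}

/-- A generator, as an element of the free algebra. -/
def gen (x : LeavittGen V E) : FreeLeavitt K V E :=
  MonoidAlgebra.single (FreeSemigroup.of x) 1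

/-- The defining relations (V), (E1), (E2), (CK1), (CK2) and their scalar multiples. The
last ones are listed because the free algebra has no unit: only with them is the ideal generated
by the relations an ideal of `K`-algebras. In (CK2) the finset `S` is `s⁻¹(a)`, so that `a` is a
regular vertex. -/
inductive Rel (G : DirectedGraph V E) : FreeLeavitt K V E → FreeLeavitt K V E → Prop
  | vertex_mul_self (a : V) : Rel G (gen K (.vertex a) * gen K (.vertex a)) (gen K (.vertex a))
  | vertex_mul_of_ne (a b : V) (h : a ≠ b) : Rel G (gen K (.vertex a) * gen K (.vertex b)) 0
  | source_mul_edge (e : E) : Rel G (gen K (.vertex (G.s e)) * gen K (.edge e)) (gen K (.edge e))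
  | edge_mul_range (e : E) : Rel G (gen K (.edge e) * gen K (.vertex (G.r e))) (gen K (.edge e))
  | range_mul_ghost (e : E) :
      Rel G (gen K (.vertex (G.r e)) * gen K (.ghost e)) (gen K (.ghost e))
  | ghost_mul_source (e : E) :
      Rel G (gen K (.ghost e) * gen K (.vertex (G.s e))) (gen K (.ghost e))
  | ghost_mul_edge_self (e : E) :
      Rel G (gen K (.ghost e) * gen K (.edge e)) (gen K (.vertex (G.r e)))
  | ghost_mul_edge_of_ne (e f : E) (h : e ≠ f) : Rel G (gen K (.ghost e) * gen K (.edge f)) 0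
  | regular (a : V) (S : Finset E) (hS : ∀ e, e ∈ S ↔ G.s e = a) (hne : S.Nonempty) :
      Rel G (gen K (.vertex a)) (∑ e ∈ S, gen K (.edge e) * gen K (.ghost e))
  | smul (c : K) (x y : FreeLeavitt K V E) (h : Rel G x y) : Rel G (c • x) (c • y)

/-- The congruence generated by the defining relations. -/
def con (G : DirectedGraph V E) : RingCon (FreeLeavitt K V E) := ringConGen (Rel K G)

theorem con_smul (G : DirectedGraph V E) (c : K) {x y : FreeLeavitt K V E} (h : con K G x y) :
    con K G (c • x) (c • y) := by
  have main : ∀ x y, RingConGen.Rel (Rel K G) x y → ∀ c : K, con K G (c • x) (c • y) := by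
    intro x y h
    induction h with
    | of x y h => exact fun c => RingConGen.Rel.of _ _ (Rel.smul c x y h)
    | refl x => exact fun c => (con K G).refl _
    | symm _ ih => exact fun c => (con K G).symm (ih c)
    | trans _ _ ih₁ ih₂ => exact fun c => (con K G).trans (ih₁ c) (ih₂ c)
    | add _ _ ih₁ ih₂ =>
      intro c
      simpa only [smul_add] using (con K G).add (ih₁ c) (ih₂ c)
    | @mul a b a' b' _ h₂ ih₁ _ =>
      intro c
      have h₂' : con K G a' b' := h₂
      simpa only [smul_mul_assoc] using (con K G).mul (ih₁ c) h₂'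
  exact main x y h c

end

end LeavittPathAlgebra

/-- The Leavitt path algebra `L_K(G)`, an associative `K`-algebra, in general without unit. -/
def LeavittPathAlgebra (K : Type w) [CommRing K] {V : Type u} {E : Type v}
    (G : DirectedGraph V E) : Type (max u v w) :=
  (LeavittPathAlgebra.con K G).Quotient

namespace LeavittPathAlgebra

noncomputable section

variable (K : Type w) [CommRing K] {V : Type u} {E : Type v} (G : DirectedGraph V E)

instance : NonUnitalRing (LeavittPathAlgebra K G) :=
  inferInstanceAs (NonUnitalRing (con K G).Quotient)

/-- The quotient map from the free algebra. -/
def mk : FreeLeavitt K V E →+ LeavittPathAlgebra K G where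
  toFun x := ((x : (con K G).Quotient) : LeavittPathAlgebra K G)
  map_zero' := rfl
  map_add' _ _ := rfl

theorem mk_surjective : Function.Surjective (mk K G) := Quotient.mk''_surjective

theorem mk_mul (x y : FreeLeavitt K V E) : mk K G (x * y) = mk K G x * mk K G y := rfl

instance : SMul K (LeavittPathAlgebra K G) :=
  ⟨fun c => Quotient.map' (c • ·) fun _ _ h => con_smul K G c h⟩

theorem mk_smul (c : K) (x : FreeLeavitt K V E) : mk K G (c • x) = c • mk K G x := rfl

instance : Module K (LeavittPathAlgebra K G) :=
  Function.Surjective.module K (mk K G) (mk_surjective K G) (mk_smul K G)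

instance : IsScalarTower K (LeavittPathAlgebra K G) (LeavittPathAlgebra K G) where
  smul_assoc c x y := by
    obtain ⟨x, rfl⟩ := mk_surjective K G x
    obtain ⟨y, rfl⟩ := mk_surjective K G y
    simp only [smul_eq_mul, ← mk_smul, ← mk_mul, smul_mul_assoc]

instance : SMulCommClass K (LeavittPathAlgebra K G) (LeavittPathAlgebra K G) where
  smul_comm c x y := by
    obtain ⟨x, rfl⟩ := mk_surjective K G x
    obtain ⟨y, rfl⟩ := mk_surjective K G y
    simp only [smul_eq_mul, ← mk_smul, ← mk_mul, mul_smul_comm]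

/-- A vertex, as an element of the Leavitt path algebra. -/
def vertex (a : V) : LeavittPathAlgebra K G := mk K G (gen K (.vertex a))

/-- An edge, as an element of the Leavitt path algebra. -/
def edge (e : E) : LeavittPathAlgebra K G := mk K G (gen K (.edge e))

/-- A ghost edge `e*`, as an element of the Leavitt path algebra. -/
def ghost (e : E) : LeavittPathAlgebra K G := mk K G (gen K (.ghost e))

/-- The element `e₁ ⋯ eₙ` of a path with source `a` (the vertex `a` if `n = 0`). -/
def pathElem : V → List E → LeavittPathAlgebra K G
  | a, [] => vertex K G a
  | _, e :: p => edge K G e * pathElem (G.r e) p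

/-- The element `eₙ* ⋯ e₁*` of a path `e₁ ⋯ eₙ` with source `a` (the vertex `a` if `n = 0`). -/
def ghostElem : V → List E → LeavittPathAlgebra K G
  | a, [] => vertex K G a
  | _, e :: p => ghostElem (G.r e) p * ghost K G e

/-- The component of degree `n` of the `ℤ`-grading of the Leavitt path algebra: the span of the
elements `α β*`, for paths `α` and `β` with the same range and `|α| - |β| = n`. -/
def component (n : ℤ) : Submodule K (LeavittPathAlgebra K G) :=
  Submodule.span K {x | ∃ (a b c : V) (α β : List E), G.IsPath a α c ∧ G.IsPath b β c ∧
    (α.length : ℤ) - (β.length : ℤ) = n ∧ x = pathElem K G a α * ghostElem K G b β}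

variable {K G} in
/-- A two-sided ideal is graded if each of its elements is a sum of homogeneous elements of the
ideal. (Every element of a Leavitt path algebra is fixed by left multiplication with a finite sum
of vertices, so two-sided ring ideals are the same as two-sided `K`-algebra ideals.) -/
def IsGradedIdeal (I : TwoSidedIdeal (LeavittPathAlgebra K G)) : Prop :=
  ∀ x ∈ I, x ∈ AddSubgroup.closure {y | y ∈ I ∧ ∃ n : ℤ, y ∈ component K G n}

/-- The Leavitt path algebra is graded simple: it is nonzero and its only graded two-sided ideals
are `0` and the whole algebra. -/
def IsGradedSimple : Prop :=
  Nontrivial (LeavittPathAlgebra K G) ∧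
    ∀ I : TwoSidedIdeal (LeavittPathAlgebra K G), IsGradedIdeal I → I = ⊥ ∨ I = ⊤

end

end LeavittPathAlgebra

/-! ### The centroid of an algebra -/

/-- The centroid of a (possibly non-unital) associative `K`-algebra `A`: the `K`-linear maps
`τ : A → A` with `τ (x y) = τ x y = x τ y`, an algebra under composition. -/
def centroid (K : Type w) (A : Type u) [CommRing K] [NonUnitalRing A] [Module K A]
    [IsScalarTower K A A] [SMulCommClass K A A] : Subalgebra K (Module.End K A) where
  carrier := {τ | ∀ x y : A, τ (x * y) = τ x * y ∧ τ (x * y) = x * τ y}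
  mul_mem' {σ τ} hσ hτ x y := by
    refine ⟨?_, ?_⟩
    · rw [Module.End.mul_apply, (hτ x y).1, (hσ _ _).1, Module.End.mul_apply]
    · rw [Module.End.mul_apply, (hτ x y).2, (hσ _ _).2, Module.End.mul_apply]
  add_mem' {σ τ} hσ hτ x y := by
    refine ⟨?_, ?_⟩
    · rw [LinearMap.add_apply, (hσ x y).1, (hτ x y).1, LinearMap.add_apply, add_mul]
    · rw [LinearMap.add_apply, (hσ x y).2, (hτ x y).2, LinearMap.add_apply, mul_add]
  algebraMap_mem' c x y := by
    refine ⟨?_, ?_⟩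
    · rw [Module.algebraMap_end_apply, Module.algebraMap_end_apply, smul_mul_assoc]
    · rw [Module.algebraMap_end_apply, Module.algebraMap_end_apply, mul_smul_comm]

/-! ### Matrices with finitely many nonzero entries -/

/-- `M_Λ(R)`: the `Λ × Λ` matrices over `R` with only finitely many nonzero entries. The index set
`Λ` may be infinite. -/
def FinMatrix (Λ : Type v) (R : Type w) [CommRing R] : Type (max v w) := Λ × Λ →₀ R

namespace FinMatrix

noncomputable section

variable {Λ : Type v} {R : Type w} [CommRing R]

instance : AddCommGroup (FinMatrix Λ R) := inferInstanceAs (AddCommGroup (Λ × Λ →₀ R))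

instance {K : Type u} [CommRing K] [Module K R] : Module K (FinMatrix Λ R) :=
  inferInstanceAs (Module K (Λ × Λ →₀ R))

/-- The entry of a matrix at the position `(i, j)`. -/
def entry (A : FinMatrix Λ R) (i j : Λ) : R := (show Λ × Λ →₀ R from A) (i, j)

@[ext]
theorem ext {A B : FinMatrix Λ R} (h : ∀ i j, A.entry i j = B.entry i j) : A = B :=
  Finsupp.ext (f := A) (g := B) fun p => h p.1 p.2

/-- The set of column indices of the nonzero entries of a matrix. -/
def cols (A : FinMatrix Λ R) : Finset Λ :=
  open scoped Classical in (show Λ × Λ →₀ R from A).support.image Prod.snd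

/-- The set of row indices of the nonzero entries of a matrix. -/
def rows (A : FinMatrix Λ R) : Finset Λ :=
  open scoped Classical in (show Λ × Λ →₀ R from A).support.image Prod.fst

theorem entry_eq_zero_of_cols {A : FinMatrix Λ R} {i j : Λ} (h : j ∉ A.cols) :
    A.entry i j = 0 := by
  classical
  by_contra hne
  exact h (Finset.mem_image.2 ⟨(i, j), Finsupp.mem_support_iff.2 hne, rfl⟩)

theorem entry_eq_zero_of_rows {A : FinMatrix Λ R} {i j : Λ} (h : i ∉ A.rows) :
    A.entry i j = 0 := by
  classical
  by_contra hne
  exact h (Finset.mem_image.2 ⟨(i, j), Finsupp.mem_support_iff.2 hne, rfl⟩)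

/-- The usual product: the entry at `(i, j)` is the (finite) sum of `A i k * B k j` over `k`. -/
instance : Mul (FinMatrix Λ R) where
  mul A B := show Λ × Λ →₀ R from
    Finsupp.onFinset (A.rows ×ˢ B.cols)
      (fun p => ∑ k ∈ A.cols, A.entry p.1 k * B.entry k p.2) (by
        intro p hp
        rw [Finset.mem_product]
        constructor
        · by_contra h
          exact hp (Finset.sum_eq_zero fun k _ => by rw [entry_eq_zero_of_rows h, zero_mul])
        · by_contra h
          exact hp (Finset.sum_eq_zero fun k _ => by rw [entry_eq_zero_of_cols h, mul_zero]))

theorem entry_mul (A B : FinMatrix Λ R) (i j : Λ) :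
    (A * B).entry i j = ∑ k ∈ A.cols, A.entry i k * B.entry k j := rfl

theorem entry_mul_of_subset (A B : FinMatrix Λ R) (i j : Λ) (S : Finset Λ) (h : A.cols ⊆ S) :
    (A * B).entry i j = ∑ k ∈ S, A.entry i k * B.entry k j := by
  rw [entry_mul]
  exact Finset.sum_subset h fun k _ hk => by rw [entry_eq_zero_of_cols hk, zero_mul]

theorem entry_add (A B : FinMatrix Λ R) (i j : Λ) :
    (A + B).entry i j = A.entry i j + B.entry i j := rfl

theorem entry_zero (i j : Λ) : (0 : FinMatrix Λ R).entry i j = 0 := rfl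

instance : NonUnitalRing (FinMatrix Λ R) where
  left_distrib A B C := by
    ext i j
    simp only [entry_mul, entry_add, mul_add, Finset.sum_add_distrib]
  right_distrib A B C := by
    classical
    ext i j
    have hA : A.cols ⊆ A.cols ∪ B.cols ∪ (A + B).cols := by
      intro k hk; simp [hk]
    have hB : B.cols ⊆ A.cols ∪ B.cols ∪ (A + B).cols := by
      intro k hk; simp [hk]
    have hAB : (A + B).cols ⊆ A.cols ∪ B.cols ∪ (A + B).cols := by
      intro k hk; simp [hk]
    rw [entry_add, entry_mul_of_subset _ _ _ _ _ hA, entry_mul_of_subset _ _ _ _ _ hB,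
      entry_mul_of_subset _ _ _ _ _ hAB, ← Finset.sum_add_distrib]
    exact Finset.sum_congr rfl fun k _ => by rw [entry_add, add_mul]
  zero_mul A := by
    ext i j
    simp [entry_mul, entry_zero]
  mul_zero A := by
    ext i j
    simp [entry_mul, entry_zero]
  mul_assoc A B C := by
    classical
    ext i j
    have h₁ : B.cols ⊆ B.cols ∪ (A * B).cols := Finset.subset_union_left
    have h₂ : (A * B).cols ⊆ B.cols ∪ (A * B).cols := Finset.subset_union_right
    rw [entry_mul_of_subset _ _ _ _ _ h₂, entry_mul A]
    simp only [entry_mul_of_subset B C _ _ _ h₁, entry_mul A B, Finset.sum_mul, Finset.mul_sum]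
    rw [Finset.sum_comm]
    exact Finset.sum_congr rfl fun k _ => Finset.sum_congr rfl fun l _ => mul_assoc _ _ _

end

end FinMatrix

/-! The argument rests on a cycle without exits and on the corner of the algebra at one of its
vertices.

Existence of the cycle. Right multiplication by edges strips ghost edges, so a nonzero ideal
contains a nonzero combination of paths from a vertex `a` to a vertex `b`. If `p` is a shortest path
in it, multiplying by `p*` turns `p` into the vertex `b` and the other paths into zero or closed
paths at `b`. If every closed path has an exit, compressing by a path that leaves through the exits
kills these, so the ideal contains a vertex (`exists_vertex_mem_of_ne_bot`). Ideals generated by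
vertices are graded, so by graded simplicity a vertex generates everything. As the algebra is not
simple, some closed path has no exit (`exists_closed_hasNoExit`); one of minimal length is a cycle
`c`, based at `b` say.

The comet. A nonempty hereditary saturated set `H` contains all vertices: functions on a branching
system over the complement of `H` form a representation that kills exactly the vertices in `H`. The
vertices from which every route is forced to reach `b` (`LeadsTo`) form such a set, and this forces
the shape of the graph.

The matrices. Without exits `c c* = c* c = b`, so the powers of `c` give a homomorphism from the
Laurent polynomials to the corner at `b`. It is injective (`cornerLift_injective`), because in a
representation over Laurent polynomials `c` acts on an indicator function as a power of `T`. Paths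
`p`, `q` that meet `b` only at their end satisfy `q* p = δ b`, so the elements `p cⁿ q*` multiply
like matrix units with entries `xⁿ`. Their span is a two-sided ideal containing `b`, hence
everything (`mem_span_firstElem`). Finally, a centroid map of matrices over a commutative ring is
multiplication by a scalar. -/

namespace LeavittPathAlgebra

/-! ### Defining relations and generation -/

section Basic

variable (K : Type w) [CommRing K] {V : Type u} {E : Type v} (G : DirectedGraph V E)

theorem mk_eq_of_rel {x y : FreeLeavitt K V E} (h : Rel K G x y) : mk K G x = mk K G y :=
  (RingCon.eq (con K G)).2 (RingConGen.Rel.of _ _ h)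

theorem vertex_mul_self (a : V) : vertex K G a * vertex K G a = vertex K G a :=
  mk_eq_of_rel K G (.vertex_mul_self a)

theorem vertex_mul_of_ne {a b : V} (h : a ≠ b) : vertex K G a * vertex K G b = 0 :=
  mk_eq_of_rel K G (.vertex_mul_of_ne a b h)

theorem source_mul_edge (e : E) : vertex K G (G.s e) * edge K G e = edge K G e :=
  mk_eq_of_rel K G (.source_mul_edge e)

theorem edge_mul_range (e : E) : edge K G e * vertex K G (G.r e) = edge K G e :=
  mk_eq_of_rel K G (.edge_mul_range e)

theorem range_mul_ghost (e : E) : vertex K G (G.r e) * ghost K G e = ghost K G e :=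
  mk_eq_of_rel K G (.range_mul_ghost e)

theorem ghost_mul_source (e : E) : ghost K G e * vertex K G (G.s e) = ghost K G e :=
  mk_eq_of_rel K G (.ghost_mul_source e)

theorem ghost_mul_edge_self (e : E) : ghost K G e * edge K G e = vertex K G (G.r e) :=
  mk_eq_of_rel K G (.ghost_mul_edge_self e)

theorem ghost_mul_edge_of_ne {e f : E} (h : e ≠ f) : ghost K G e * edge K G f = 0 :=
  mk_eq_of_rel K G (.ghost_mul_edge_of_ne e f h)

theorem vertex_eq_sum (a : V) (S : Finset E) (hS : ∀ e, e ∈ S ↔ G.s e = a) (hne : S.Nonempty) :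
    vertex K G a = ∑ e ∈ S, edge K G e * ghost K G e := by
  refine (mk_eq_of_rel K G (.regular a S hS hne)).trans ?_
  rw [map_sum]
  rfl

theorem vertex_mul_edge_of_ne {a : V} {e : E} (h : a ≠ G.s e) :
    vertex K G a * edge K G e = 0 := by
  rw [← source_mul_edge, ← mul_assoc, vertex_mul_of_ne K G h, zero_mul]

theorem ghost_mul_vertex_of_ne {a : V} {e : E} (h : G.s e ≠ a) :
    ghost K G e * vertex K G a = 0 := by
  rw [← ghost_mul_source, mul_assoc, vertex_mul_of_ne K G h, mul_zero]

variable {K G}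

/-- Induction principle: the vertices, edges and ghost edges generate the algebra. -/
theorem induction {p : LeavittPathAlgebra K G → Prop} (hv : ∀ a, p (vertex K G a))
    (he : ∀ e, p (edge K G e)) (hg : ∀ e, p (ghost K G e)) (zero : p 0)
    (add : ∀ x y, p x → p y → p (x + y)) (smul : ∀ (k : K) x, p x → p (k • x))
    (mul : ∀ x y, p x → p y → p (x * y)) (x : LeavittPathAlgebra K G) : p x := by
  obtain ⟨x, rfl⟩ := mk_surjective K G x
  have hword : ∀ w : FreeSemigroup (LeavittGen V E), p (mk K G (MonoidAlgebra.single w 1)) := by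
    intro w
    induction w using FreeSemigroup.recOnMul with
    | ih1 g => cases g with
      | vertex a => exact hv a
      | edge e => exact he e
      | ghost e => exact hg e
    | ih2 g w hx hy =>
      have h : (MonoidAlgebra.single (FreeSemigroup.of g * w) 1 : FreeLeavitt K V E) =
          MonoidAlgebra.single (FreeSemigroup.of g) 1 * MonoidAlgebra.single w 1 := by
        rw [MonoidAlgebra.single_mul_single, one_mul]
      rw [h, mk_mul]
      exact mul _ _ hx hy
  induction x using MonoidAlgebra.induction_linear with
  | zero => rw [map_zero]; exact zero
  | add f g hf hg => rw [map_add]; exact add _ _ hf hg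
  | single w k =>
    have h : (MonoidAlgebra.single w k : FreeLeavitt K V E) =
        k • MonoidAlgebra.single w 1 := by
      rw [MonoidAlgebra.smul_single, smul_eq_mul, mul_one]
    rw [h, mk_smul]
    exact smul _ _ (hword w)

end Basic

/-! ### The universal property -/

section Lift

variable {K : Type w} [CommRing K] {V : Type u} {E : Type v} {G : DirectedGraph V E}
  {A : Type*} [NonUnitalRing A] [Module K A] [IsScalarTower K A A] [SMulCommClass K A A]

/-- A family of elements of an algebra which satisfies the relations of the Leavitt path
algebra. -/
structure IsFamily (G : DirectedGraph V E) (P : V → A) (S T : E → A) : Prop where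
  vertex_mul_self (a : V) : P a * P a = P a
  vertex_mul_of_ne (a b : V) (h : a ≠ b) : P a * P b = 0
  source_mul_edge (e : E) : P (G.s e) * S e = S e
  edge_mul_range (e : E) : S e * P (G.r e) = S e
  range_mul_ghost (e : E) : P (G.r e) * T e = T e
  ghost_mul_source (e : E) : T e * P (G.s e) = T e
  ghost_mul_edge_self (e : E) : T e * S e = P (G.r e)
  ghost_mul_edge_of_ne (e f : E) (h : e ≠ f) : T e * S f = 0
  regular (a : V) (F : Finset E) (hF : ∀ e, e ∈ F ↔ G.s e = a) (hne : F.Nonempty) :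
    P a = ∑ e ∈ F, S e * T e

/-- The values of a family on the generators. -/
def genMap (P : V → A) (S T : E → A) : LeavittGen V E → A
  | .vertex a => P a
  | .edge e => S e
  | .ghost e => T e

noncomputable section

/-- The homomorphism from the free algebra given by the images of the generators. -/
def freeLift (f : LeavittGen V E → A) : FreeLeavitt K V E →ₙₐ[K] A :=
  MonoidAlgebra.liftMagma K (FreeSemigroup.lift f)

theorem freeLift_gen (f : LeavittGen V E → A) (g : LeavittGen V E) :
    freeLift (K := K) f (gen K g) = f g := by
  simp [freeLift, gen, MonoidAlgebra.liftMagma_apply_apply]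

theorem freeLift_eq_of_con {P : V → A} {S T : E → A} (h : IsFamily G P S T)
    {x y : FreeLeavitt K V E} (hxy : con K G x y) :
    freeLift (K := K) (genMap P S T) x = freeLift (genMap P S T) y := by
  have hrel : ∀ x y, Rel K G x y →
      freeLift (K := K) (genMap P S T) x = freeLift (genMap P S T) y := by
    intro x y hxy
    induction hxy with
    | smul c x y _ ih => rw [map_smul, map_smul, ih]
    | vertex_mul_self a => simpa only [map_mul, freeLift_gen, genMap] using h.vertex_mul_self a
    | vertex_mul_of_ne a b hab =>
      simpa only [map_mul, freeLift_gen, genMap, map_zero] using h.vertex_mul_of_ne a b hab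
    | source_mul_edge e => simpa only [map_mul, freeLift_gen, genMap] using h.source_mul_edge e
    | edge_mul_range e => simpa only [map_mul, freeLift_gen, genMap] using h.edge_mul_range e
    | range_mul_ghost e => simpa only [map_mul, freeLift_gen, genMap] using h.range_mul_ghost e
    | ghost_mul_source e => simpa only [map_mul, freeLift_gen, genMap] using h.ghost_mul_source e
    | ghost_mul_edge_self e => simpa only [map_mul, freeLift_gen, genMap] using h.ghost_mul_edge_self e
    | ghost_mul_edge_of_ne e f hef =>
      simpa only [map_mul, freeLift_gen, genMap, map_zero] using h.ghost_mul_edge_of_ne e f hef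
    | regular a F hF hne =>
      simpa only [map_mul, freeLift_gen, genMap, map_sum] using h.regular a F hF hne
  have main : ∀ x y, RingConGen.Rel (Rel K G) x y →
      freeLift (K := K) (genMap P S T) x = freeLift (genMap P S T) y := by
    intro x y hxy
    induction hxy with
    | of x y h => exact hrel x y h
    | refl => rfl
    | symm _ ih => exact ih.symm
    | trans _ _ ih₁ ih₂ => exact ih₁.trans ih₂
    | add _ _ ih₁ ih₂ => rw [map_add, map_add, ih₁, ih₂]
    | mul _ _ ih₁ ih₂ => rw [map_mul, map_mul, ih₁, ih₂]
  exact main x y hxy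

/-- The universal property of the Leavitt path algebra. -/
def lift {P : V → A} {S T : E → A} (h : IsFamily G P S T) : LeavittPathAlgebra K G →ₙₐ[K] A where
  toFun := Quotient.lift (freeLift (K := K) (genMap P S T)) fun _ _ hxy => freeLift_eq_of_con h hxy
  map_smul' c x := by
    obtain ⟨x, rfl⟩ := mk_surjective K G x
    exact map_smul (freeLift (K := K) (genMap P S T)) c x
  map_zero' := map_zero (freeLift (K := K) (genMap P S T))
  map_add' x y := by
    obtain ⟨x, rfl⟩ := mk_surjective K G x
    obtain ⟨y, rfl⟩ := mk_surjective K G y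
    exact map_add (freeLift (K := K) (genMap P S T)) x y
  map_mul' x y := by
    obtain ⟨x, rfl⟩ := mk_surjective K G x
    obtain ⟨y, rfl⟩ := mk_surjective K G y
    exact map_mul (freeLift (K := K) (genMap P S T)) x y

variable {P : V → A} {S T : E → A} (h : IsFamily G P S T)

theorem lift_vertex (a : V) : lift (K := K) h (vertex K G a) = P a :=
  freeLift_gen (genMap P S T) (.vertex a)

theorem lift_edge (e : E) : lift (K := K) h (edge K G e) = S e :=
  freeLift_gen (genMap P S T) (.edge e)

theorem lift_ghost (e : E) : lift (K := K) h (ghost K G e) = T e :=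
  freeLift_gen (genMap P S T) (.ghost e)

end

end Lift

/-! ### The involution -/

noncomputable section Involution

open MulOpposite

variable {K : Type w} [CommRing K] {V : Type u} {E : Type v} {G : DirectedGraph V E}

instance : IsScalarTower K (LeavittPathAlgebra K G)ᵐᵒᵖ (LeavittPathAlgebra K G)ᵐᵒᵖ where
  smul_assoc c x y := unop_injective <| by
    simp only [smul_eq_mul, unop_mul, unop_smul, mul_smul_comm]

instance : SMulCommClass K (LeavittPathAlgebra K G)ᵐᵒᵖ (LeavittPathAlgebra K G)ᵐᵒᵖ where
  smul_comm c x y := unop_injective <| by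
    simp only [smul_eq_mul, unop_mul, unop_smul, smul_mul_assoc]

/-- The relations are invariant under reversing products and exchanging edges with ghost edges. The
universal property, applied to the opposite algebra, therefore yields the involution, which later
halves every left-right argument. -/
theorem isFamily_op : IsFamily G (fun a => op (vertex K G a)) (fun e => op (ghost K G e))
    (fun e => op (edge K G e)) where
  vertex_mul_self a := by rw [← op_mul, vertex_mul_self]
  vertex_mul_of_ne a b h := by rw [← op_mul, vertex_mul_of_ne K G h.symm, op_zero]
  source_mul_edge e := by rw [← op_mul, ghost_mul_source]
  edge_mul_range e := by rw [← op_mul, range_mul_ghost]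
  range_mul_ghost e := by rw [← op_mul, edge_mul_range]
  ghost_mul_source e := by rw [← op_mul, source_mul_edge]
  ghost_mul_edge_self e := by rw [← op_mul, ghost_mul_edge_self]
  ghost_mul_edge_of_ne e f h := by rw [← op_mul, ghost_mul_edge_of_ne K G h.symm, op_zero]
  regular a F hF hne := by
    simp only [← op_mul, ← Finset.op_sum]
    rw [← vertex_eq_sum K G a F hF hne]

/-- The involution which fixes the vertices and interchanges `e` and `e*`. -/
def adj : LeavittPathAlgebra K G →ₗ[K] LeavittPathAlgebra K G where
  toFun x := unop (lift (K := K) isFamily_op x)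
  map_add' x y := by rw [map_add, unop_add]
  map_smul' c x := by rw [map_smul, unop_smul]; rfl

theorem adj_mul (x y : LeavittPathAlgebra K G) : adj (x * y) = adj y * adj x :=
  congrArg unop (map_mul (lift (K := K) isFamily_op) x y)

@[simp]
theorem adj_vertex (a : V) : adj (vertex K G a) = vertex K G a :=
  congrArg unop (lift_vertex isFamily_op a)

@[simp]
theorem adj_edge (e : E) : adj (edge K G e) = ghost K G e :=
  congrArg unop (lift_edge isFamily_op e)

@[simp]
theorem adj_ghost (e : E) : adj (ghost K G e) = edge K G e :=
  congrArg unop (lift_ghost isFamily_op e)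

@[simp]
theorem adj_adj (x : LeavittPathAlgebra K G) : adj (adj x) = x := by
  induction x using induction with
  | hv a => simp
  | he e => simp
  | hg e => simp
  | zero => simp
  | add x y hx hy => rw [map_add, map_add, hx, hy]
  | smul k x hx => rw [map_smul, map_smul, hx]
  | mul x y hx hy => rw [adj_mul, adj_mul, hx, hy]

@[simp]
theorem adj_pathElem (a : V) (p : List E) : adj (pathElem K G a p) = ghostElem K G a p := by
  induction p generalizing a with
  | nil => exact adj_vertex a
  | cons e p ih => rw [pathElem, ghostElem, adj_mul, ih, adj_edge]

@[simp]
theorem adj_ghostElem (a : V) (p : List E) : adj (ghostElem K G a p) = pathElem K G a p := by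
  rw [← adj_pathElem, adj_adj]

end Involution

/-! ### Products of paths and ghost paths -/

section Paths

variable {K : Type w} [CommRing K] {V : Type u} {E : Type v} {G : DirectedGraph V E}

theorem vertex_mul_pathElem {a b : V} {p : List E} (h : G.IsPath a p b) :
    vertex K G a * pathElem K G a p = pathElem K G a p := by
  cases p with
  | nil => exact vertex_mul_self K G a
  | cons e p => rw [pathElem, ← h.1, ← mul_assoc, source_mul_edge]

theorem vertex_mul_pathElem_of_ne {a b c : V} {p : List E} (h : G.IsPath a p b) (hc : c ≠ a) :
    vertex K G c * pathElem K G a p = 0 := by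
  rw [← vertex_mul_pathElem h, ← mul_assoc, vertex_mul_of_ne K G hc, zero_mul]

theorem pathElem_mul_vertex {a b : V} {p : List E} (h : G.IsPath a p b) :
    pathElem K G a p * vertex K G b = pathElem K G a p := by
  induction p generalizing a with
  | nil => obtain rfl : a = b := h; exact vertex_mul_self K G a
  | cons e p ih => rw [pathElem, mul_assoc, ih h.2]

theorem pathElem_mul_vertex_of_ne {a b c : V} {p : List E} (h : G.IsPath a p b) (hc : b ≠ c) :
    pathElem K G a p * vertex K G c = 0 := by
  rw [← pathElem_mul_vertex h, mul_assoc, vertex_mul_of_ne K G hc, mul_zero]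

theorem ghostElem_mul_vertex {a b : V} {p : List E} (h : G.IsPath a p b) :
    ghostElem K G a p * vertex K G a = ghostElem K G a p := by
  simpa [adj_mul] using congrArg adj (vertex_mul_pathElem (K := K) h)

theorem ghostElem_mul_vertex_of_ne {a b c : V} {p : List E} (h : G.IsPath a p b) (hc : c ≠ a) :
    ghostElem K G a p * vertex K G c = 0 := by
  simpa [adj_mul] using congrArg adj (vertex_mul_pathElem_of_ne (K := K) h hc)

theorem vertex_mul_ghostElem {a b : V} {p : List E} (h : G.IsPath a p b) :
    vertex K G b * ghostElem K G a p = ghostElem K G a p := by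
  simpa [adj_mul] using congrArg adj (pathElem_mul_vertex (K := K) h)

theorem isPath_append {a b c : V} {p q : List E} (hp : G.IsPath a p b) (hq : G.IsPath b q c) :
    G.IsPath a (p ++ q) c := by
  induction p generalizing a with
  | nil => obtain rfl : a = b := hp; exact hq
  | cons e p ih => exact ⟨hp.1, ih hp.2⟩

theorem isPath_append_iff {a c : V} {p q : List E} :
    G.IsPath a (p ++ q) c ↔ ∃ b, G.IsPath a p b ∧ G.IsPath b q c := by
  refine ⟨fun h => ?_, fun ⟨b, hp, hq⟩ => isPath_append hp hq⟩
  induction p generalizing a with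
  | nil => exact ⟨a, rfl, h⟩
  | cons e p ih =>
    obtain ⟨b, hb, hq⟩ := ih h.2
    exact ⟨b, ⟨h.1, hb⟩, hq⟩

theorem pathElem_append {a b c : V} {p q : List E} (hp : G.IsPath a p b) (hq : G.IsPath b q c) :
    pathElem K G a (p ++ q) = pathElem K G a p * pathElem K G b q := by
  induction p generalizing a with
  | nil => obtain rfl : a = b := hp; exact (vertex_mul_pathElem hq).symm
  | cons e p ih => rw [List.cons_append, pathElem, pathElem, ih hp.2, mul_assoc]

theorem ghostElem_append {a b c : V} {p q : List E} (hp : G.IsPath a p b) (hq : G.IsPath b q c) :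
    ghostElem K G a (p ++ q) = ghostElem K G b q * ghostElem K G a p := by
  simpa [adj_mul] using congrArg adj (pathElem_append (K := K) hp hq)

theorem ghostElem_mul_pathElem_self {a b : V} {p : List E} (hp : G.IsPath a p b) :
    ghostElem K G a p * pathElem K G a p = vertex K G b := by
  induction p generalizing a with
  | nil => obtain rfl : a = b := hp; exact vertex_mul_self K G a
  | cons e p ih =>
    rw [pathElem, ghostElem, mul_assoc, ← mul_assoc (ghost K G e), ghost_mul_edge_self,
      vertex_mul_pathElem hp.2, ih hp.2]

/-- The product `p* q` of a ghost path and a path which is at least as long. -/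
theorem ghostElem_mul_pathElem {a b c : V} {p q : List E} (hp : G.IsPath a p b)
    (hq : G.IsPath a q c) (hle : p.length ≤ q.length) :
    (∃ q', q = p ++ q' ∧ G.IsPath b q' c ∧
      ghostElem K G a p * pathElem K G a q = pathElem K G b q') ∨
    ghostElem K G a p * pathElem K G a q = 0 := by
  induction p generalizing a q with
  | nil =>
    obtain rfl : a = b := hp
    exact Or.inl ⟨q, rfl, hq, vertex_mul_pathElem hq⟩
  | cons e p ih =>
    cases q with
    | nil => simp at hle
    | cons f q =>
      rw [pathElem, ghostElem, mul_assoc, ← mul_assoc (ghost K G e)]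
      by_cases hef : e = f
      · subst hef
        rw [ghost_mul_edge_self, vertex_mul_pathElem hq.2]
        rcases ih hp.2 hq.2 (by simpa using hle) with ⟨q', rfl, h₁, h₂⟩ | h
        · exact Or.inl ⟨q', rfl, h₁, h₂⟩
        · exact Or.inr h
      · right
        rw [ghost_mul_edge_of_ne K G hef, zero_mul, mul_zero]

end Paths

end LeavittPathAlgebra

/-! ### Branching systems over complements of hereditary saturated sets -/

namespace DirectedGraph

variable {V : Type u} {E : Type v} (G : DirectedGraph V E)

/-- A branching system: a set `X` fibred over the vertices, in which the fibre of `a` is split into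
copies of the fibres of the ranges of the edges which `a` emits. -/
structure BranchingSystem (X : Type*) where
  src : X → V
  head : X → Option E
  tail : X → X
  cons : E → X → X
  source_head {x e} : head x = some e → G.s e = src x
  src_tail {x e} : head x = some e → src (tail x) = G.r e
  cons_tail {x e} : head x = some e → cons e (tail x) = x
  head_cons {x e} : src x = G.r e → head (cons e x) = some e
  tail_cons {x e} : src x = G.r e → tail (cons e x) = x
  ne_source {x} : head x = none → ∀ e, G.s e ≠ src x

/-- Hereditary and saturated sets of vertices (of a graph without infinite emitters). -/
structure IsHereditarySaturated (H : Set V) : Prop where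
  hereditary : ∀ e, G.s e ∈ H → G.r e ∈ H
  saturated : ∀ a, (∃ e, G.s e = a) → (∀ e, G.s e = a → G.r e ∈ H) → a ∈ H

variable {G}

/-- The complement of a hereditary saturated set is the base of a branching system whose fibres
are countably infinite. -/
theorem exists_branchingSystem (hrow : G.RowFinite) {H : Set V} (hH : G.IsHereditarySaturated H) :
    ∃ B : G.BranchingSystem (↥(Hᶜ) × ℕ), ∀ x, B.src x = x.1 := by
  classical
  -- By saturation some edge of `a` stays outside `H`, and by row-finiteness there are finitely many
  -- such edges. So their product with `ℕ` is countably infinite, and the fibre `ℕ` can be split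
  -- into one copy of itself per edge.
  have hσ : ∀ a : ↥(Hᶜ), (∃ e, G.s e = a) →
      Nonempty (ℕ ≃ {e // G.s e = a ∧ G.r e ∉ H} × ℕ) := by
    intro a ha
    have hfin : Finite {e // G.s e = a ∧ G.r e ∉ H} :=
      Set.Finite.subset (hrow a) fun e he => he.1
    have hne : Nonempty {e // G.s e = a ∧ G.r e ∉ H} := by
      by_contra hcon
      refine a.2 (hH.saturated a ha fun e he => ?_)
      by_contra hr
      exact hcon ⟨⟨e, he, hr⟩⟩
    exact nonempty_equiv_of_countable
  obtain ⟨σ⟩ : Nonempty (∀ a : ↥(Hᶜ), (∃ e, G.s e = a) →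
      (ℕ ≃ {e // G.s e = a ∧ G.r e ∉ H} × ℕ)) := ⟨fun a ha => (hσ a ha).some⟩
  have hs : ∀ e, G.r e ∉ H → G.s e ∈ Hᶜ := fun e he h => he (hH.hereditary e h)
  -- `a` equals the source of `e` only propositionally; this transports `σ` along that equality.
  have key : ∀ (a : ↥(Hᶜ)) (ha : ∃ e, G.s e = a) (e : E) (he : G.s e = a) (hr : G.r e ∉ H)
      (n : ℕ), (σ ⟨G.s e, hs e hr⟩ ⟨e, rfl⟩).symm (⟨e, rfl, hr⟩, n) =
        (σ a ha).symm (⟨e, he, hr⟩, n) := by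
    intro a ha e he hr n
    obtain rfl : a = ⟨G.s e, hs e hr⟩ := Subtype.ext he.symm
    rfl
  refine ⟨{
    src := fun x => x.1
    head := fun x => if h : ∃ e, G.s e = x.1 then some (σ x.1 h x.2).1 else none
    tail := fun x => if h : ∃ e, G.s e = x.1 then
      (⟨G.r (σ x.1 h x.2).1, (σ x.1 h x.2).1.2.2⟩, (σ x.1 h x.2).2) else x
    cons := fun e x => if h : G.r e ∉ H then
      (⟨G.s e, hs e h⟩, (σ ⟨G.s e, hs e h⟩ ⟨e, rfl⟩).symm (⟨e, rfl, h⟩, x.2)) else x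
    source_head := ?_
    src_tail := ?_
    cons_tail := ?_
    head_cons := ?_
    tail_cons := ?_
    ne_source := ?_ }, fun _ => rfl⟩
  · intro x e hx
    by_cases h : ∃ e, G.s e = x.1
    · simp only [dif_pos h, Option.some.injEq] at hx
      rw [← hx]
      exact (σ x.1 h x.2).1.2.1
    · simp [dif_neg h] at hx
  · intro x e hx
    by_cases h : ∃ e, G.s e = x.1
    · simp only [dif_pos h, Option.some.injEq] at hx ⊢
      rw [← hx]
    · simp [dif_neg h] at hx
  · intro x e hx
    by_cases h : ∃ e, G.s e = x.1
    · simp only [dif_pos h, Option.some.injEq] at hx ⊢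
      obtain ⟨x, n⟩ := x
      subst hx
      rw [dif_pos (σ x h n).1.2.2]
      refine Prod.ext (Subtype.ext (σ x h n).1.2.1) ?_
      exact (key x h _ (σ x h n).1.2.1 (σ x h n).1.2.2 _).trans ((σ x h).symm_apply_apply n)
    · simp [dif_neg h] at hx
  · intro x e hx
    have hr : G.r e ∉ H := hx ▸ x.1.2
    -- The point is generalized to `y`, since the condition and the proof under the `if` both depend
    -- on it.
    have aux : ∀ y : ↥(Hᶜ) × ℕ,
        y = (⟨G.s e, hs e hr⟩, (σ ⟨G.s e, hs e hr⟩ ⟨e, rfl⟩).symm (⟨e, rfl, hr⟩, x.2)) →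
        (if h : ∃ e, G.s e = y.1 then some (σ y.1 h y.2).1.1 else none) = some e := by
      rintro _ rfl
      have h : ∃ f, G.s f = G.s e := ⟨e, rfl⟩
      simp [h]
    exact aux _ (dif_pos hr)
  · rintro ⟨⟨x, hx'⟩, n⟩ e hx
    obtain rfl : x = G.r e := hx
    have hr : G.r e ∉ H := hx'
    have aux : ∀ y : ↥(Hᶜ) × ℕ,
        y = (⟨G.s e, hs e hr⟩, (σ ⟨G.s e, hs e hr⟩ ⟨e, rfl⟩).symm (⟨e, rfl, hr⟩, n)) →
        (if h : ∃ e, G.s e = y.1 then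
          ((⟨G.r (σ y.1 h y.2).1, (σ y.1 h y.2).1.2.2⟩ : ↥(Hᶜ)), (σ y.1 h y.2).2) else y) =
          (⟨G.r e, hx'⟩, n) := by
      rintro _ rfl
      have h : ∃ f, G.s f = G.s e := ⟨e, rfl⟩
      simp [h]
    exact aux _ (dif_pos hr)
  · intro x hx e he
    have h : ∃ e, G.s e = x.1 := ⟨e, he⟩
    simp [dif_pos h] at hx

end DirectedGraph

/-! ### Representations on functions on a branching system -/

namespace LeavittPathAlgebra

open DirectedGraph

noncomputable section Representation

open scoped Classical in
/-- The operator of a vertex on functions on a branching system. -/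
def vertexOp {V : Type u} {E : Type v} {G : DirectedGraph V E} {X : Type*}
    (B : G.BranchingSystem X) (R : Type*) [CommRing R] (a : V) : Module.End R (X → R) where
  toFun f x := if B.src x = a then f x else 0
  map_add' f g := by ext x; by_cases h : B.src x = a <;> simp [h]
  map_smul' c f := by ext x; by_cases h : B.src x = a <;> simp [h]

open scoped Classical in
/-- The operator of an edge on functions on a branching system, twisted by a unit. -/
def edgeOp {V : Type u} {E : Type v} {G : DirectedGraph V E} {X : Type*}
    (B : G.BranchingSystem X) {R : Type*} [CommRing R] (t : Rˣ) (e : E) :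
    Module.End R (X → R) where
  toFun f x := if B.head x = some e then t * f (B.tail x) else 0
  map_add' f g := by ext x; by_cases h : B.head x = some e <;> simp [h, mul_add]
  map_smul' c f := by ext x; by_cases h : B.head x = some e <;> simp [h, mul_left_comm]

open scoped Classical in
/-- The operator of a ghost edge on functions on a branching system, twisted by a unit. -/
def ghostOp {V : Type u} {E : Type v} {G : DirectedGraph V E} {X : Type*}
    (B : G.BranchingSystem X) {R : Type*} [CommRing R] (t : Rˣ) (e : E) :
    Module.End R (X → R) where
  toFun f x := if B.src x = G.r e then (t⁻¹ : Rˣ) * f (B.cons e x) else 0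
  map_add' f g := by ext x; by_cases h : B.src x = G.r e <;> simp [h, mul_add]
  map_smul' c f := by ext x; by_cases h : B.src x = G.r e <;> simp [h, mul_left_comm]

variable {V : Type u} {E : Type v} {G : DirectedGraph V E} {X : Type*}
  (B : G.BranchingSystem X) {R : Type*} [CommRing R] (t : Rˣ)

open scoped Classical in
theorem vertexOp_apply (a : V) (f : X → R) (x : X) :
    vertexOp B R a f x = if B.src x = a then f x else 0 := rfl

open scoped Classical in
theorem edgeOp_apply (e : E) (f : X → R) (x : X) :
    edgeOp B t e f x = if B.head x = some e then t * f (B.tail x) else 0 := rfl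

open scoped Classical in
theorem ghostOp_apply (e : E) (f : X → R) (x : X) :
    ghostOp B t e f x = if B.src x = G.r e then (t⁻¹ : Rˣ) * f (B.cons e x) else 0 := rfl

theorem edgeOp_mul_ghostOp_apply (e : E) (f : X → R) (x : X) [Decidable (B.head x = some e)] :
    (edgeOp B t e * ghostOp B t e) f x = if B.head x = some e then f x else 0 := by
  rw [Module.End.mul_apply, edgeOp_apply]
  split_ifs with h
  · rw [ghostOp_apply, if_pos (B.src_tail h), B.cons_tail h, Units.mul_inv_cancel_left]
  · rfl

/-- A vertex restricts functions to its fibre, `e` pulls back along `tail` on the points with head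
`e`, and `e*` pulls back along `cons e`. The factors `t` and `t⁻¹` cancel in `e* e` and `e e*`.
(CK2) holds because `head` partitions the fibre of a vertex that emits edges. -/
theorem isFamily_branching : IsFamily G (vertexOp B R) (edgeOp B t) (ghostOp B t) where
  vertex_mul_self a := by
    ext1 f; funext x
    simp only [Module.End.mul_apply, vertexOp_apply]
    split_ifs <;> rfl
  vertex_mul_of_ne a b h := by
    ext1 f; funext x
    simp only [Module.End.mul_apply, vertexOp_apply]
    split_ifs with h₁ h₂
    · exact absurd (h₁.symm.trans h₂) h
    · rfl
    · rfl
  source_mul_edge e := by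
    ext1 f; funext x
    simp only [Module.End.mul_apply, vertexOp_apply, edgeOp_apply]
    split_ifs with h₁ h₂ h₂
    · rfl
    · rfl
    · exact absurd (B.source_head h₂).symm h₁
    · rfl
  edge_mul_range e := by
    ext1 f; funext x
    simp only [Module.End.mul_apply, vertexOp_apply, edgeOp_apply]
    split_ifs with h₁ h₂
    · rfl
    · exact absurd (B.src_tail h₁) h₂
    · rfl
  range_mul_ghost e := by
    ext1 f; funext x
    simp only [Module.End.mul_apply, vertexOp_apply, ghostOp_apply]
    split_ifs <;> rfl
  ghost_mul_source e := by
    ext1 f; funext x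
    simp only [Module.End.mul_apply, vertexOp_apply, ghostOp_apply]
    split_ifs with h₁ h₂
    · rfl
    · exact absurd (B.source_head (B.head_cons h₁)).symm h₂
    · rfl
  ghost_mul_edge_self e := by
    ext1 f; funext x
    simp only [Module.End.mul_apply, vertexOp_apply, ghostOp_apply, edgeOp_apply]
    split_ifs with h₁ h₂
    · rw [B.tail_cons h₁, Units.inv_mul_cancel_left]
    · exact absurd (B.head_cons h₁) h₂
    · rfl
  ghost_mul_edge_of_ne e f h := by
    ext1 g; funext x
    simp only [Module.End.mul_apply, ghostOp_apply, edgeOp_apply]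
    split_ifs with h₁ h₂
    · exact absurd (Option.some.inj ((B.head_cons h₁).symm.trans h₂)) h
    · exact mul_zero _
    · rfl
  regular a F hF hne := by
    classical
    ext1 f; funext x
    rw [LinearMap.sum_apply, Finset.sum_apply, vertexOp_apply]
    simp only [edgeOp_mul_ghostOp_apply]
    cases hx : B.head x with
    | none =>
      obtain ⟨e, he⟩ := hne
      have := B.ne_source hx e
      rw [(hF e).1 he] at this
      rw [if_neg this.symm]
      simp
    | some e =>
      have hs := B.source_head hx
      simp only [Option.some.injEq]
      rw [Finset.sum_ite_eq]
      refine if_congr ?_ rfl rfl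
      rw [hF, hs]

end Representation

section Consequences

variable {K : Type w} [Field K] {V : Type u} {E : Type v} {G : DirectedGraph V E}

/-- The branching system for the empty set has a nonempty fibre over every vertex, so `a` acts as a
nonzero restriction. -/
theorem vertex_ne_zero (hrow : G.RowFinite) (a : V) : vertex K G a ≠ 0 := by
  intro h0
  obtain ⟨B, hB⟩ := exists_branchingSystem (H := ∅) hrow
    ⟨fun _ h => h, fun a ⟨e, he⟩ h => h e he⟩
  have h := lift_vertex (K := K) (isFamily_branching B (1 : Kˣ)) a
  rw [h0, map_zero] at h
  have h' := congrFun (LinearMap.congr_fun h (fun _ => 1)) (⟨a, fun h => h⟩, 0)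
  rw [vertexOp_apply, if_pos (hB _)] at h'
  exact zero_ne_one h'

/-- A vertex in the ideal generated by another vertex `b` belongs to every hereditary saturated
set which contains `b`. -/
theorem mem_of_vertex_mem_span (hrow : G.RowFinite) {H : Set V} (hH : G.IsHereditarySaturated H)
    {a b : V} (hb : b ∈ H) (h : vertex K G a ∈ TwoSidedIdeal.span {vertex K G b}) : a ∈ H := by
  by_contra ha
  obtain ⟨B, hB⟩ := exists_branchingSystem hrow hH
  set ρ := lift (K := K) (isFamily_branching B (1 : Kˣ)) with hρ
  -- No point lies over a vertex of `H`, so the representation kills `b` and the ideal it generates,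
  -- whereas the fibre over `a` is nonempty.
  have hker : TwoSidedIdeal.span {vertex K G b} ≤ TwoSidedIdeal.comap ρ ⊥ := by
    rw [TwoSidedIdeal.span_le, Set.singleton_subset_iff, SetLike.mem_coe,
      TwoSidedIdeal.mem_comap, TwoSidedIdeal.mem_bot, hρ, lift_vertex]
    ext1 f; funext x
    rw [vertexOp_apply, if_neg]
    · rfl
    · rw [hB]
      exact fun h => x.1.2 (h ▸ hb)
  have h0 := hker h
  rw [TwoSidedIdeal.mem_comap, TwoSidedIdeal.mem_bot, hρ, lift_vertex] at h0
  have h' := congrFun (LinearMap.congr_fun h0 (fun _ => 1)) (⟨a, ha⟩, 0)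
  rw [vertexOp_apply, if_pos (hB _)] at h'
  exact one_ne_zero h'

end Consequences

end LeavittPathAlgebra

/-! ### Local units and graded ideals -/

namespace LeavittPathAlgebra

section Graded

variable {K : Type w} [CommRing K] {V : Type u} {E : Type v} {G : DirectedGraph V E}

theorem sum_vertex_mul {x : LeavittPathAlgebra K G} {a : V} (h : vertex K G a * x = x)
    {F : Finset V} (ha : a ∈ F) : (∑ b ∈ F, vertex K G b) * x = x := by
  rw [Finset.sum_mul, Finset.sum_eq_single_of_mem a ha, h]
  intro b _ hb
  rw [← h, ← mul_assoc, vertex_mul_of_ne K G hb, zero_mul]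

/-- Asking for all larger sets `F'` lets the two summands of a sum share one local unit. -/
theorem exists_sum_vertex_mul (x : LeavittPathAlgebra K G) :
    ∃ F : Finset V, ∀ F', F ⊆ F' → (∑ b ∈ F', vertex K G b) * x = x := by
  classical
  induction x using induction with
  | hv a => exact ⟨{a}, fun F' h => sum_vertex_mul (vertex_mul_self K G a)
      (Finset.singleton_subset_iff.1 h)⟩
  | he e => exact ⟨{G.s e}, fun F' h => sum_vertex_mul (source_mul_edge K G e)
      (Finset.singleton_subset_iff.1 h)⟩
  | hg e => exact ⟨{G.r e}, fun F' h => sum_vertex_mul (range_mul_ghost K G e)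
      (Finset.singleton_subset_iff.1 h)⟩
  | zero => exact ⟨∅, fun F' _ => mul_zero _⟩
  | add x y hx hy =>
    obtain ⟨F, hF⟩ := hx
    obtain ⟨F', hF'⟩ := hy
    refine ⟨F ∪ F', fun D hD => ?_⟩
    rw [mul_add, hF D (Finset.union_subset_left hD), hF' D (Finset.union_subset_right hD)]
  | smul k x hx =>
    obtain ⟨F, hF⟩ := hx
    exact ⟨F, fun F' h => by rw [mul_smul_comm, hF F' h]⟩
  | mul x y hx hy =>
    obtain ⟨F, hF⟩ := hx
    exact ⟨F, fun F' h => by rw [← mul_assoc, hF F' h]⟩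

theorem exists_vertex_mul_ne_zero {x : LeavittPathAlgebra K G} (hx : x ≠ 0) :
    ∃ a, vertex K G a * x ≠ 0 := by
  obtain ⟨F, hF⟩ := exists_sum_vertex_mul x
  by_contra! h
  apply hx
  rw [← hF F subset_rfl, Finset.sum_mul]
  exact Finset.sum_eq_zero fun a _ => h a

theorem exists_mul_vertex_ne_zero {x : LeavittPathAlgebra K G} (hx : x ≠ 0) :
    ∃ a, x * vertex K G a ≠ 0 := by
  obtain ⟨a, ha⟩ := exists_vertex_mul_ne_zero (x := adj x) (fun h => hx (by simpa using congrArg adj h))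
  refine ⟨a, fun h => ha ?_⟩
  simpa [adj_mul] using congrArg adj h

/-- A local unit `u` of `x` turns the scalar into a ring multiplier: `k x = (k u) x`. -/
theorem smul_mem_ideal (I : TwoSidedIdeal (LeavittPathAlgebra K G)) (k : K)
    {x : LeavittPathAlgebra K G} (hx : x ∈ I) : k • x ∈ I := by
  obtain ⟨F, hF⟩ := exists_sum_vertex_mul x
  rw [← hF F subset_rfl, ← smul_mul_assoc]
  exact I.mul_mem_left _ _ hx

theorem vertex_mem_component (a : V) : vertex K G a ∈ component K G 0 :=
  Submodule.subset_span ⟨a, a, a, [], [], rfl, rfl, rfl, (vertex_mul_self K G a).symm⟩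

theorem adj_mem_component {n : ℤ} {x : LeavittPathAlgebra K G} (hx : x ∈ component K G n) :
    adj x ∈ component K G (-n) := by
  have h : component K G n ≤ (component K G (-n)).comap adj := by
    refine Submodule.span_le.2 ?_
    rintro _ ⟨a, b, c, α, β, hα, hβ, rfl, rfl⟩
    refine Submodule.subset_span ⟨b, a, c, β, α, hβ, hα, by ring, ?_⟩
    rw [adj_mul, adj_pathElem, adj_ghostElem]
  exact h hx

theorem vertex_mul_mem_component (d : V) {n : ℤ} {x : LeavittPathAlgebra K G}
    (hx : x ∈ component K G n) : vertex K G d * x ∈ component K G n := by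
  have h : component K G n ≤
      (component K G n).comap (LinearMap.mulLeft K (vertex K G d)) := by
    refine Submodule.span_le.2 ?_
    rintro _ ⟨a, b, c, α, β, hα, hβ, rfl, rfl⟩
    rw [SetLike.mem_coe, Submodule.mem_comap, LinearMap.mulLeft_apply, ← mul_assoc]
    by_cases hd : d = a
    · subst hd
      rw [vertex_mul_pathElem hα]
      exact Submodule.subset_span ⟨d, b, c, α, β, hα, hβ, rfl, rfl⟩
    · rw [vertex_mul_pathElem_of_ne hα hd, zero_mul]
      exact zero_mem _
  exact h hx

theorem edge_mul_mem_component (e : E) {n : ℤ} {x : LeavittPathAlgebra K G}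
    (hx : x ∈ component K G n) : edge K G e * x ∈ component K G (n + 1) := by
  have h : component K G n ≤
      (component K G (n + 1)).comap (LinearMap.mulLeft K (edge K G e)) := by
    refine Submodule.span_le.2 ?_
    rintro _ ⟨a, b, c, α, β, hα, hβ, rfl, rfl⟩
    rw [SetLike.mem_coe, Submodule.mem_comap, LinearMap.mulLeft_apply, ← mul_assoc]
    by_cases hd : G.r e = a
    · subst hd
      exact Submodule.subset_span ⟨G.s e, b, c, e :: α, β, ⟨rfl, hα⟩, hβ,
        by rw [List.length_cons]; push_cast; ring, rfl⟩
    · rw [← edge_mul_range, mul_assoc (edge K G e), vertex_mul_pathElem_of_ne hα hd, mul_zero,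
        zero_mul]
      exact zero_mem _
  exact h hx

theorem ghost_mul_mem_component (e : E) {n : ℤ} {x : LeavittPathAlgebra K G}
    (hx : x ∈ component K G n) : ghost K G e * x ∈ component K G (n - 1) := by
  have h : component K G n ≤
      (component K G (n - 1)).comap (LinearMap.mulLeft K (ghost K G e)) := by
    refine Submodule.span_le.2 ?_
    rintro _ ⟨a, b, c, α, β, hα, hβ, rfl, rfl⟩
    rw [SetLike.mem_coe, Submodule.mem_comap, LinearMap.mulLeft_apply, ← mul_assoc]
    cases α with
    -- Against a path of length zero nothing cancels; `e*` is absorbed into the ghost path, which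
    -- becomes the ghost of `β e`.
    | nil =>
      obtain rfl : a = c := hα
      by_cases hs : G.s e = a
      · subst hs
        have he : G.IsPath (G.s e) [e] (G.r e) := ⟨rfl, rfl⟩
        refine Submodule.subset_span ⟨G.r e, b, G.r e, [], β ++ [e], rfl, isPath_append hβ he,
          by simp; ring, ?_⟩
        rw [ghostElem_append hβ he, pathElem, pathElem, ghostElem, ghostElem, ghost_mul_source,
          range_mul_ghost, ← mul_assoc, range_mul_ghost]
      · rw [pathElem, ghost_mul_vertex_of_ne K G hs, zero_mul]
        exact zero_mem _
    | cons f α =>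
      rw [pathElem, ← mul_assoc]
      by_cases hef : e = f
      · subst hef
        rw [ghost_mul_edge_self, vertex_mul_pathElem hα.2]
        exact Submodule.subset_span ⟨G.r e, b, c, α, β, hα.2, hβ, by simp; ring, rfl⟩
      · rw [ghost_mul_edge_of_ne K G hef, zero_mul, zero_mul]
        exact zero_mem _
  exact h hx

/-- The additive group spanned by the homogeneous elements of an ideal. -/
noncomputable def homogeneousPart (I : TwoSidedIdeal (LeavittPathAlgebra K G)) :
    AddSubgroup (LeavittPathAlgebra K G) :=
  AddSubgroup.closure {y | y ∈ I ∧ ∃ n : ℤ, y ∈ component K G n}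

variable (I : TwoSidedIdeal (LeavittPathAlgebra K G))

theorem map_mem_homogeneousPart {I J : TwoSidedIdeal (LeavittPathAlgebra K G)}
    (f : LeavittPathAlgebra K G →+ LeavittPathAlgebra K G)
    (h : ∀ y ∈ I, ∀ n : ℤ, y ∈ component K G n → f y ∈ J ∧ ∃ n : ℤ, f y ∈ component K G n)
    {y : LeavittPathAlgebra K G} (hy : y ∈ homogeneousPart I) : f y ∈ homogeneousPart J := by
  have hle : homogeneousPart I ≤ (homogeneousPart J).comap f := by
    refine (AddSubgroup.closure_le _).2 ?_
    rintro y ⟨hy, n, hn⟩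
    exact AddSubgroup.subset_closure (h y hy n hn)
  exact hle hy

/-- It suffices to multiply by generators, and each of these maps every component into a single
component. Products of general homogeneous elements are never needed. -/
theorem mul_mem_homogeneousPart (x : LeavittPathAlgebra K G) {y : LeavittPathAlgebra K G}
    (hy : y ∈ homogeneousPart I) : x * y ∈ homogeneousPart I := by
  induction x using induction generalizing y with
  | hv a =>
    exact map_mem_homogeneousPart (AddMonoidHom.mulLeft (vertex K G a))
      (fun y hy n hn => ⟨I.mul_mem_left _ _ hy, n, vertex_mul_mem_component a hn⟩) hy
  | he e =>
    exact map_mem_homogeneousPart (AddMonoidHom.mulLeft (edge K G e))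
      (fun y hy n hn => ⟨I.mul_mem_left _ _ hy, _, edge_mul_mem_component e hn⟩) hy
  | hg e =>
    exact map_mem_homogeneousPart (AddMonoidHom.mulLeft (ghost K G e))
      (fun y hy n hn => ⟨I.mul_mem_left _ _ hy, _, ghost_mul_mem_component e hn⟩) hy
  | zero => rw [zero_mul]; exact zero_mem _
  | add x x' hx hx' => rw [add_mul]; exact add_mem (hx hy) (hx' hy)
  | smul k x hx =>
    rw [smul_mul_assoc]
    exact map_mem_homogeneousPart (DistribSMul.toAddMonoidHom _ k)
      (fun y hy n hn => ⟨smul_mem_ideal I k hy, n, Submodule.smul_mem _ _ hn⟩) (hx hy)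
  | mul x x' hx hx' => rw [mul_assoc]; exact hx (hx' hy)

/-- The image of an ideal under the involution. -/
noncomputable def adjIdeal : TwoSidedIdeal (LeavittPathAlgebra K G) :=
  TwoSidedIdeal.mk' {x | adj x ∈ I} (by simp [zero_mem])
    (fun hx hy => by simpa using add_mem hx hy) (fun hx => by simpa using hx)
    (fun {x y} hy => by simpa [adj_mul] using I.mul_mem_right _ _ hy)
    (fun {x y} hx => by simpa [adj_mul] using I.mul_mem_left _ _ hx)

theorem mem_adjIdeal {x : LeavittPathAlgebra K G} : x ∈ adjIdeal I ↔ adj x ∈ I :=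
  TwoSidedIdeal.mem_mk' ..

theorem adj_mem_homogeneousPart {y : LeavittPathAlgebra K G} (hy : y ∈ homogeneousPart I) :
    adj y ∈ homogeneousPart (adjIdeal I) :=
  map_mem_homogeneousPart (adj (K := K) (G := G)).toAddMonoidHom
    (fun y hy _ hn => ⟨(mem_adjIdeal I).2 ((adj_adj y).symm ▸ hy), _, adj_mem_component hn⟩) hy

theorem adjIdeal_adjIdeal : adjIdeal (adjIdeal I) = I := by
  ext x
  rw [mem_adjIdeal, mem_adjIdeal, adj_adj]

/-- The involution negates degrees and exchanges left with right multiplication, so the left-hand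
version for `adjIdeal I` suffices. -/
theorem homogeneousPart_mul_mem (x : LeavittPathAlgebra K G) {y : LeavittPathAlgebra K G}
    (hy : y ∈ homogeneousPart I) : y * x ∈ homogeneousPart I := by
  have h := adj_mem_homogeneousPart _
    (mul_mem_homogeneousPart _ (adj x) (adj_mem_homogeneousPart I hy))
  rwa [adjIdeal_adjIdeal, adj_mul, adj_adj, adj_adj] at h

/-- An ideal which is generated by vertices is graded. -/
theorem isGradedIdeal_span_vertex (S : Set V) :
    IsGradedIdeal (TwoSidedIdeal.span (vertex K G '' S)) := by
  set J := TwoSidedIdeal.span (vertex K G '' S) with hJ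
  let A : TwoSidedIdeal (LeavittPathAlgebra K G) :=
    TwoSidedIdeal.mk' (homogeneousPart J) (zero_mem _) (fun hx hy => add_mem hx hy)
      (fun hx => neg_mem hx) (fun hy => mul_mem_homogeneousPart J _ hy)
      (fun hx => homogeneousPart_mul_mem J _ hx)
  have hA : J ≤ A := by
    rw [hJ, TwoSidedIdeal.span_le]
    rintro _ ⟨a, ha, rfl⟩
    refine (TwoSidedIdeal.mem_mk' _ _ _ _ _ _ _).2 (AddSubgroup.subset_closure ⟨?_, 0, ?_⟩)
    · exact TwoSidedIdeal.subset_span ⟨a, ha, rfl⟩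
    · exact vertex_mem_component a
  intro x hx
  exact (TwoSidedIdeal.mem_mk' _ _ _ _ _ _ _).1 (hA hx)

end Graded

/-! ### Consequences of graded simplicity -/

section GradedSimple

variable {K : Type w} [Field K] {V : Type u} {E : Type v} {G : DirectedGraph V E}

theorem span_vertex_eq_top (hrow : G.RowFinite) (h : IsGradedSimple K G) (a : V) :
    TwoSidedIdeal.span {vertex K G a} = ⊤ := by
  have hgr := isGradedIdeal_span_vertex (K := K) (G := G) {a}
  rw [Set.image_singleton] at hgr
  refine (h.2 _ hgr).resolve_left fun hbot => vertex_ne_zero (K := K) hrow a ?_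
  rw [← TwoSidedIdeal.mem_bot, ← hbot]
  exact TwoSidedIdeal.subset_span rfl

theorem eq_univ_of_isHereditarySaturated (hrow : G.RowFinite) (h : IsGradedSimple K G)
    {H : Set V} (hH : G.IsHereditarySaturated H) (hne : H.Nonempty) (a : V) : a ∈ H := by
  obtain ⟨b, hb⟩ := hne
  refine mem_of_vertex_mem_span (K := K) hrow hH hb ?_
  rw [span_vertex_eq_top hrow h]
  trivial

end GradedSimple

end LeavittPathAlgebra

/-! ### From nonzero ideals to vertices when closed paths have exits -/

namespace DirectedGraph

variable {V : Type u} {E : Type v}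

/-- A path has no exit if each of its edges is the only edge emitted by its source. -/
def HasNoExit (G : DirectedGraph V E) (p : List E) : Prop :=
  ∀ e ∈ p, ∀ f, G.s f = G.s e → f = e

end DirectedGraph

namespace LeavittPathAlgebra

open DirectedGraph

section Reduction

variable {K : Type w} [Field K] {V : Type u} {E : Type v} {G : DirectedGraph V E}

/-- `η` follows `γ` up to the source of an exit `f` and then leaves through `f`; its last edge
differs from the edge of `γ` at that place, so the product vanishes. -/
theorem exists_ghostElem_mul_pathElem_eq_zero {b c : V} {γ : List E} (hγ : G.IsPath b γ c)
    (hexit : ¬ G.HasNoExit γ) :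
    ∃ η d, G.IsPath b η d ∧ ghostElem K G b η * pathElem K G b γ = 0 := by
  simp only [HasNoExit] at hexit
  push Not at hexit
  obtain ⟨e, he, f, hf, hfe⟩ := hexit
  obtain ⟨l₁, l₂, rfl⟩ := List.append_of_mem he
  obtain ⟨a, h₁, h₂⟩ := isPath_append_iff.1 hγ
  obtain rfl := h₂.1
  have h₃ : G.IsPath (G.s e) [f] (G.r f) := ⟨hf, rfl⟩
  refine ⟨l₁ ++ [f], G.r f, isPath_append h₁ h₃, ?_⟩
  rw [ghostElem_append h₁ h₃, pathElem_append h₁ h₂, mul_assoc,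
    ← mul_assoc (ghostElem K G b l₁), ghostElem_mul_pathElem_self h₁, vertex_mul_pathElem h₂,
    ghostElem, pathElem, mul_assoc, ← mul_assoc (ghost K G f), ghost_mul_edge_of_ne K G hfe,
    zero_mul, mul_zero]

variable (K G) in
/-- Elements which are zero or a closed path of positive length at `b`. -/
def IsZeroOrClosed (b : V) (z : LeavittPathAlgebra K G) : Prop :=
  z = 0 ∨ ∃ γ, G.IsPath b γ b ∧ γ ≠ [] ∧ z = pathElem K G b γ

/-- Either `η* γ η` vanishes or `γ η` begins with `η`; then what remains is a closed path at `d` of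
the same length as `γ`, hence not trivial. -/
theorem IsZeroOrClosed.conj {b d : V} {z : LeavittPathAlgebra K G} (hz : IsZeroOrClosed K G b z)
    {η : List E} (hη : G.IsPath b η d) :
    IsZeroOrClosed K G d (ghostElem K G b η * z * pathElem K G b η) := by
  rcases hz with rfl | ⟨γ, hγ, hne, rfl⟩
  · left; rw [mul_zero, zero_mul]
  · rw [mul_assoc, ← pathElem_append hγ hη]
    rcases ghostElem_mul_pathElem (K := K) hη (isPath_append hγ hη) (by simp) with
      ⟨q, hq, hpath, h⟩ | h
    · refine Or.inr ⟨q, hpath, ?_, h⟩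
      rintro rfl
      have := congrArg List.length hq
      simp [List.length_eq_zero_iff, hne] at this
    · exact Or.inl h

/-- The elements are killed one at a time. A compression keeps the remaining ones zero or closed
(`IsZeroOrClosed.conj`), so the path can be prolonged through an exit of the next one. -/
theorem exists_conj_eq_zero
    (hL : ∀ b γ, G.IsPath b γ b → γ ≠ [] → ¬ G.HasNoExit γ) (b : V)
    (T : Finset (LeavittPathAlgebra K G)) (hT : ∀ z ∈ T, IsZeroOrClosed K G b z) :
    ∃ η d, G.IsPath b η d ∧
      ∀ z ∈ T, ghostElem K G b η * z * pathElem K G b η = 0 := by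
  classical
  induction T using Finset.induction_on with
  | empty => exact ⟨[], b, rfl, by simp⟩
  | insert z T _ ih =>
    obtain ⟨η, d, hη, h⟩ := ih fun z hz => hT z (Finset.mem_insert_of_mem hz)
    have key : ∃ η' d', G.IsPath d η' d' ∧
        ghostElem K G d η' * (ghostElem K G b η * z * pathElem K G b η) = 0 := by
      rcases (hT z (Finset.mem_insert_self z T)).conj hη with h0 | ⟨γ, hγ, hne, h0⟩
      · exact ⟨[], d, rfl, by rw [h0, mul_zero]⟩
      · rw [h0]
        exact exists_ghostElem_mul_pathElem_eq_zero hγ (hL d γ hγ hne)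
    obtain ⟨η', d', hη', h'⟩ := key
    refine ⟨η ++ η', d', isPath_append hη hη', fun x hx => ?_⟩
    have hassoc : ghostElem K G b (η ++ η') * x * pathElem K G b (η ++ η') =
        ghostElem K G d η' * (ghostElem K G b η * x * pathElem K G b η) *
          pathElem K G d η' := by
      rw [ghostElem_append hη hη', pathElem_append hη hη']
      simp only [mul_assoc]
    rw [hassoc]
    rcases Finset.mem_insert.1 hx with rfl | hx
    · rw [h', zero_mul]
    · rw [h x hx, mul_zero, zero_mul]

/-- If closed paths have exits, an ideal which contains a nonzero linear combination of paths
contains a vertex. -/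
theorem exists_vertex_mem_of_mem_span
    (hL : ∀ b γ, G.IsPath b γ b → γ ≠ [] → ¬ G.HasNoExit γ)
    (I : TwoSidedIdeal (LeavittPathAlgebra K G)) {a b : V} {y : LeavittPathAlgebra K G}
    (hy : y ∈ Submodule.span K (pathElem K G a '' {p | G.IsPath a p b})) (hy0 : y ≠ 0)
    (hyI : y ∈ I) : ∃ d, vertex K G d ∈ I := by
  classical
  obtain ⟨f, hf, rfl⟩ := (Finsupp.mem_span_image_iff_linearCombination K).1 hy
  rw [Finsupp.mem_supported] at hf
  have hne : f.support.Nonempty := by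
    rw [Finsupp.support_nonempty_iff]
    rintro rfl
    exact hy0 (map_zero _)
  -- Minimality of `p` ensures that `p*` never outlasts another path `q` of the support: `p* q` is
  -- zero or a closed path at `b`, of positive length because `q ≠ p`.
  obtain ⟨p, hp, hmin⟩ := f.support.exists_min_image List.length hne
  have hpp : G.IsPath a p b := hf hp
  have hT : ∀ z ∈ (f.support.erase p).image
      (fun q => ghostElem K G a p * pathElem K G a q), IsZeroOrClosed K G b z := by
    intro z hz
    obtain ⟨q, hq, rfl⟩ := Finset.mem_image.1 hz
    obtain ⟨hqp, hq⟩ := Finset.mem_erase.1 hq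
    rcases ghostElem_mul_pathElem (K := K) hpp (hf hq) (hmin q hq) with ⟨q', h₁, h₂, h₃⟩ | h
    · refine Or.inr ⟨q', h₂, ?_, h₃⟩
      rintro rfl
      exact hqp (by rw [h₁, List.append_nil])
    · exact Or.inl h
  obtain ⟨η, d, hη, h⟩ := exists_conj_eq_zero hL b _ hT
  refine ⟨d, ?_⟩
  have hval : ghostElem K G b η * (ghostElem K G a p * Finsupp.linearCombination K
      (pathElem K G a) f) * pathElem K G b η = f p • vertex K G d := by
    rw [Finsupp.linearCombination_apply, Finsupp.sum, Finset.mul_sum, Finset.mul_sum,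
      Finset.sum_mul, Finset.sum_eq_single_of_mem p hp]
    · rw [mul_smul_comm, mul_smul_comm, smul_mul_assoc, ghostElem_mul_pathElem_self hpp,
        ghostElem_mul_vertex hη, ghostElem_mul_pathElem_self hη]
    · intro q hq hqp
      rw [mul_smul_comm, mul_smul_comm, smul_mul_assoc,
        h _ (Finset.mem_image_of_mem _ (Finset.mem_erase.2 ⟨hqp, hq⟩)), smul_zero]
  have hmem : f p • vertex K G d ∈ I := by
    rw [← hval]
    exact I.mul_mem_right _ _ (I.mul_mem_left _ _ (I.mul_mem_left _ _ hyI))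
  have := smul_mem_ideal I (f p)⁻¹ hmem
  rwa [inv_smul_smul₀ (Finsupp.mem_support_iff.1 hp)] at this

variable (K G) in
/-- The span of the elements `α β*` with `β` of length at most `n`. -/
noncomputable def ghostFiltration (n : ℕ) : Submodule K (LeavittPathAlgebra K G) :=
  Submodule.span K {x | ∃ (a b c : V) (α β : List E), G.IsPath a α c ∧ G.IsPath b β c ∧
    β.length ≤ n ∧ x = pathElem K G a α * ghostElem K G b β}

theorem ghostFiltration_mono {m n : ℕ} (h : m ≤ n) :
    ghostFiltration K G m ≤ ghostFiltration K G n := by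
  refine Submodule.span_mono ?_
  rintro _ ⟨a, b, c, α, β, hα, hβ, hn, rfl⟩
  exact ⟨a, b, c, α, β, hα, hβ, hn.trans h, rfl⟩

theorem exists_mul_sum_vertex (x : LeavittPathAlgebra K G) :
    ∃ F : Finset V, x * ∑ b ∈ F, vertex K G b = x := by
  obtain ⟨F, hF⟩ := exists_sum_vertex_mul (adj x)
  refine ⟨F, ?_⟩
  simpa [adj_mul] using congrArg adj (hF F subset_rfl)

/-- `x` is `x` times a sum of vertices, vertices have degree zero, and the homogeneous part is
closed under left multiplication. Thus the elements `α β*` span the algebra. -/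
theorem mem_homogeneousPart_top (x : LeavittPathAlgebra K G) :
    x ∈ homogeneousPart (K := K) (G := G) ⊤ := by
  obtain ⟨F, hF⟩ := exists_mul_sum_vertex x
  rw [← hF]
  exact mul_mem_homogeneousPart _ _ (sum_mem fun a _ =>
    AddSubgroup.subset_closure ⟨trivial, 0, vertex_mem_component a⟩)

theorem exists_mem_ghostFiltration (x : LeavittPathAlgebra K G) :
    ∃ n, x ∈ ghostFiltration K G n := by
  have hadd : ∀ x y : LeavittPathAlgebra K G, (∃ n, x ∈ ghostFiltration K G n) →
      (∃ n, y ∈ ghostFiltration K G n) → ∃ n, x + y ∈ ghostFiltration K G n := by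
    rintro x y ⟨m, hm⟩ ⟨n, hn⟩
    exact ⟨max m n, add_mem (ghostFiltration_mono (le_max_left m n) hm)
      (ghostFiltration_mono (le_max_right m n) hn)⟩
  induction mem_homogeneousPart_top x using AddSubgroup.closure_induction with
  | mem x hx =>
    obtain ⟨-, n, hn⟩ := hx
    induction hn using Submodule.span_induction with
    | mem x hx =>
      obtain ⟨a, b, c, α, β, hα, hβ, -, rfl⟩ := hx
      exact ⟨β.length, Submodule.subset_span ⟨a, b, c, α, β, hα, hβ, le_rfl, rfl⟩⟩
    | zero => exact ⟨0, zero_mem _⟩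
    | add x y _ _ hx hy => exact hadd x y hx hy
    | smul k x _ hx => exact hx.imp fun n hn => Submodule.smul_mem _ k hn
  | zero => exact ⟨0, zero_mem _⟩
  | add x y _ _ hx hy => exact hadd x y hx hy
  | neg x _ hx => exact hx.imp fun n hn => neg_mem hn

/-- The ghost of `f :: β` has `f*` as its rightmost factor, which `e` either cancels or annihilates.
If there is no ghost edge, `e` prolongs `α`. -/
theorem mul_edge_mem_ghostFiltration {n : ℕ} {x : LeavittPathAlgebra K G}
    (hx : x ∈ ghostFiltration K G (n + 1)) (e : E) : x * edge K G e ∈ ghostFiltration K G n := by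
  have h : ghostFiltration K G (n + 1) ≤
      (ghostFiltration K G n).comap (LinearMap.mulRight K (edge K G e)) := by
    refine Submodule.span_le.2 ?_
    rintro _ ⟨a, b, c, α, β, hα, hβ, hn, rfl⟩
    rw [SetLike.mem_coe, Submodule.mem_comap, LinearMap.mulRight_apply, mul_assoc]
    cases β with
    | nil =>
      obtain rfl : b = c := hβ
      rw [ghostElem]
      by_cases hs : b = G.s e
      · subst hs
        have he : G.IsPath (G.s e) [e] (G.r e) := ⟨rfl, rfl⟩
        refine Submodule.subset_span ⟨a, G.r e, G.r e, α ++ [e], [], isPath_append hα he, rfl,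
          Nat.zero_le n, ?_⟩
        rw [pathElem_append hα he, pathElem, pathElem, ghostElem, source_mul_edge, edge_mul_range,
          mul_assoc, edge_mul_range]
      · rw [vertex_mul_edge_of_ne K G hs, mul_zero]
        exact zero_mem _
    | cons f β =>
      rw [ghostElem, mul_assoc (ghostElem K G (G.r f) β)]
      by_cases hef : f = e
      · subst hef
        rw [ghost_mul_edge_self, ghostElem_mul_vertex hβ.2]
        exact Submodule.subset_span ⟨a, G.r f, c, α, β, hα, hβ.2, by simpa using hn, rfl⟩
      · rw [ghost_mul_edge_of_ne K G hef, mul_zero, mul_zero]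
        exact zero_mem _
  exact h hx

/-- A nontrivial ghost path ends on the right in some `f*`, and `f* d = 0` unless `d` emits `f`. -/
theorem mul_sink_mem_ghostFiltration {n : ℕ} {x : LeavittPathAlgebra K G}
    (hx : x ∈ ghostFiltration K G n) {d : V} (hd : ∀ e, G.s e ≠ d) :
    x * vertex K G d ∈ ghostFiltration K G 0 := by
  have h : ghostFiltration K G n ≤
      (ghostFiltration K G 0).comap (LinearMap.mulRight K (vertex K G d)) := by
    refine Submodule.span_le.2 ?_
    rintro _ ⟨a, b, c, α, β, hα, hβ, hn, rfl⟩
    rw [SetLike.mem_coe, Submodule.mem_comap, LinearMap.mulRight_apply, mul_assoc]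
    cases β with
    | nil =>
      by_cases hb : d = b
      · subst hb
        rw [ghostElem_mul_vertex hβ]
        exact Submodule.subset_span ⟨a, d, c, α, [], hα, hβ, le_rfl, rfl⟩
      · rw [ghostElem_mul_vertex_of_ne hβ hb, mul_zero]
        exact zero_mem _
    | cons f β =>
      rw [ghostElem, mul_assoc (ghostElem K G (G.r f) β), ghost_mul_vertex_of_ne K G (hd f),
        mul_zero, mul_zero]
      exact zero_mem _
  exact h hx

/-- A nonzero ideal contains a nonzero linear combination of paths. -/
theorem exists_mem_ghostFiltration_zero (hrow : G.RowFinite)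
    (I : TwoSidedIdeal (LeavittPathAlgebra K G)) {n : ℕ} {x : LeavittPathAlgebra K G} (hx : x ∈ I)
    (hx0 : x ≠ 0) (hn : x ∈ ghostFiltration K G n) :
    ∃ y ∈ I, y ≠ 0 ∧ y ∈ ghostFiltration K G 0 := by
  induction n generalizing x with
  | zero => exact ⟨x, hx, hx0, hn⟩
  | succ n ih =>
    obtain ⟨a, ha⟩ := exists_mul_vertex_ne_zero hx0
    -- If `a` emits edges, (CK2) writes `x a` as the sum of the `x e e*`, so some `x e` is nonzero
    -- and has shorter ghost parts. If `a` is a sink, `x a` is already free of ghost edges.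
    by_cases hs : ∃ e, G.s e = a
    · have hsum := vertex_eq_sum K G a (hrow a).toFinset (by simp)
        (by obtain ⟨e, he⟩ := hs; exact ⟨e, by simpa using he⟩)
      have : ∃ e, x * edge K G e ≠ 0 := by
        by_contra! hcon
        apply ha
        rw [hsum, Finset.mul_sum]
        exact Finset.sum_eq_zero fun e _ => by rw [← mul_assoc, hcon e, zero_mul]
      obtain ⟨e, he⟩ := this
      exact ih (I.mul_mem_right _ _ hx) he (mul_edge_mem_ghostFiltration hn e)
    · push Not at hs
      exact ⟨_, I.mul_mem_right _ _ hx, ha, mul_sink_mem_ghostFiltration hn hs⟩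

theorem vertex_mul_vertex_mem_span {x : LeavittPathAlgebra K G} (hx : x ∈ ghostFiltration K G 0)
    (a b : V) : vertex K G a * x * vertex K G b ∈
      Submodule.span K (pathElem K G a '' {p | G.IsPath a p b}) := by
  have h : ghostFiltration K G 0 ≤ (Submodule.span K (pathElem K G a '' {p | G.IsPath a p b})).comap
      (LinearMap.mulRight K (vertex K G b) ∘ₗ LinearMap.mulLeft K (vertex K G a)) := by
    refine Submodule.span_le.2 ?_
    rintro _ ⟨a', b', c, α, β, hα, hβ, hn, rfl⟩
    obtain rfl : β = [] := List.length_eq_zero_iff.1 (Nat.le_zero.1 hn)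
    obtain rfl : b' = c := hβ
    rw [SetLike.mem_coe, Submodule.mem_comap, LinearMap.comp_apply, LinearMap.mulRight_apply,
      LinearMap.mulLeft_apply, ghostElem, pathElem_mul_vertex hα]
    by_cases ha : a = a'
    · subst ha
      rw [vertex_mul_pathElem hα]
      by_cases hb : b' = b
      · subst hb
        rw [pathElem_mul_vertex hα]
        exact Submodule.subset_span ⟨α, hα, rfl⟩
      · rw [pathElem_mul_vertex_of_ne hα hb]
        exact zero_mem _
    · rw [vertex_mul_pathElem_of_ne hα ha, zero_mul]
      exact zero_mem _
  exact h hx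

/-- If every closed path has an exit, every nonzero ideal contains a vertex. -/
theorem exists_vertex_mem_of_ne_bot (hrow : G.RowFinite)
    (hL : ∀ b γ, G.IsPath b γ b → γ ≠ [] → ¬ G.HasNoExit γ)
    {I : TwoSidedIdeal (LeavittPathAlgebra K G)} (hI : I ≠ ⊥) : ∃ d, vertex K G d ∈ I := by
  have : ∃ x ∈ I, x ≠ 0 := by
    by_contra! hcon
    refine hI (le_bot_iff.1 fun x hx => ?_)
    exact (TwoSidedIdeal.mem_bot _).2 (hcon x hx)
  obtain ⟨x, hx, hx0⟩ := this
  obtain ⟨n, hn⟩ := exists_mem_ghostFiltration x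
  obtain ⟨y, hyI, hy0, hy⟩ := exists_mem_ghostFiltration_zero hrow I hx hx0 hn
  obtain ⟨a, ha⟩ := exists_vertex_mul_ne_zero hy0
  obtain ⟨b, hb⟩ := exists_mul_vertex_ne_zero ha
  exact exists_vertex_mem_of_mem_span hL I (vertex_mul_vertex_mem_span hy a b) hb
    (I.mul_mem_right _ _ (I.mul_mem_left _ _ hyI))

/-- Otherwise every nonzero ideal contains a vertex, and a vertex generates the whole algebra. -/
theorem exists_closed_hasNoExit (hrow : G.RowFinite) (h : IsGradedSimple K G)
    (hsimple : ¬ IsSimpleRing (LeavittPathAlgebra K G)) :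
    ∃ b γ, G.IsPath b γ b ∧ γ ≠ [] ∧ G.HasNoExit γ := by
  by_contra! hL
  have := h.1
  refine hsimple ⟨{ eq_bot_or_eq_top := fun I => or_iff_not_imp_left.2 fun hI => ?_ }⟩
  obtain ⟨d, hd⟩ := exists_vertex_mem_of_ne_bot hrow hL hI
  rw [eq_top_iff, ← span_vertex_eq_top hrow h d, TwoSidedIdeal.span_le,
    Set.singleton_subset_iff]
  exact hd

end Reduction

end LeavittPathAlgebra

/-! ### Cycles without exits and comets -/

namespace DirectedGraph

variable {V : Type u} {E : Type v} {G : DirectedGraph V E}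

open LeavittPathAlgebra

theorem exists_eq_append_of_not_nodup_map {α β : Type*} (f : α → β) {l : List α}
    (h : ¬ (l.map f).Nodup) :
    ∃ l₁ a l₂ b l₃, l = l₁ ++ a :: (l₂ ++ b :: l₃) ∧ f a = f b := by
  induction l with
  | nil => simp at h
  | cons a l ih =>
    by_cases ha : f a ∈ l.map f
    · obtain ⟨b, hb, hab⟩ := List.mem_map.1 ha
      obtain ⟨l₂, l₃, rfl⟩ := List.append_of_mem hb
      exact ⟨[], a, l₂, b, l₃, rfl, hab.symm⟩
    · rw [List.map_cons, List.nodup_cons] at h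
      obtain ⟨l₁, b, l₂, c, l₃, rfl, hbc⟩ := ih fun hl => h ⟨ha, hl⟩
      exact ⟨a :: l₁, b, l₂, c, l₃, rfl, hbc⟩

/-- A closed path of minimal length without exits is a cycle. -/
theorem exists_isCycle_hasNoExit (h : ∃ b γ, G.IsPath b γ b ∧ γ ≠ [] ∧ G.HasNoExit γ) :
    ∃ b c, G.IsPath b c b ∧ G.IsCycle c ∧ G.HasNoExit c := by
  classical
  have hex : ∃ n b γ, γ.length = n ∧ G.IsPath b γ b ∧ γ ≠ [] ∧ G.HasNoExit γ := by
    obtain ⟨b, γ, h⟩ := h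
    exact ⟨_, b, γ, rfl, h⟩
  obtain ⟨b, c, hlen, hc, hne, hexit⟩ := Nat.find_spec hex
  refine ⟨b, c, hc, ⟨hne, ⟨b, hc⟩, ?_⟩, hexit⟩
  by_contra hdup
  obtain ⟨l₁, e, l₂, f, l₃, rfl, hef⟩ := exists_eq_append_of_not_nodup_map G.s hdup
  obtain ⟨a, -, h₂⟩ := isPath_append_iff.1 hc
  obtain ⟨a', h₃, h₄⟩ := isPath_append_iff.1 h₂.2
  have hclosed : G.IsPath (G.s e) (e :: l₂) (G.s e) := by
    refine ⟨rfl, ?_⟩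
    rw [hef, h₄.1]
    exact h₃
  -- A repeated source cuts out the strictly shorter closed path `e :: l₂`, which inherits the
  -- absence of exits.
  refine Nat.find_min hex (m := (e :: l₂).length) ?_ ⟨G.s e, e :: l₂, rfl, hclosed, by simp, ?_⟩
  · rw [← hlen]
    simp
    omega
  · intro g hg
    refine hexit g ?_
    simp only [List.mem_append, List.mem_cons] at hg ⊢
    tauto

/-- The hereditary saturated closure of a cycle without exits through `b`: the vertices all of whose
paths lead to `b`. -/
inductive LeadsTo (G : DirectedGraph V E) (b : V) : V → Prop
  | base : LeadsTo G b b
  | step (a : V) (hne : ∃ e, G.s e = a) (h : ∀ e, G.s e = a → LeadsTo G b (G.r e)) : LeadsTo G b a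

theorem leadsTo_of_isPath {a b : V} {p : List E} (hp : G.IsPath a p b) (hexit : G.HasNoExit p) :
    G.LeadsTo b a := by
  induction p generalizing a with
  | nil => obtain rfl : a = b := hp; exact .base
  | cons e p ih =>
    refine .step a ⟨e, hp.1⟩ fun f hf => ?_
    obtain rfl : f = e := hexit e List.mem_cons_self f (hf.trans hp.1.symm)
    exact ih hp.2 fun g hg => hexit g (List.mem_cons_of_mem _ hg)

/-- Saturation is the constructor `step`. For heredity only `b` itself needs an argument: it emits
just the first edge of `c`, and the rest of `c` leads back to `b`. -/
theorem isHereditarySaturated_leadsTo {b : V} {c : List E} (hc : G.IsPath b c b) (hne : c ≠ [])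
    (hexit : G.HasNoExit c) : G.IsHereditarySaturated {a | G.LeadsTo b a} where
  hereditary e he := by
    generalize hs : G.s e = a at he
    cases he with
    | step _ _ h => exact h e hs
    | base =>
      cases c with
      | nil => exact absurd rfl hne
      | cons f p =>
        obtain rfl : e = f := hexit f List.mem_cons_self e (hs.trans hc.1.symm)
        exact leadsTo_of_isPath hc.2 fun g hg => hexit g (List.mem_cons_of_mem _ hg)
  saturated a ha h := LeadsTo.step a ha h

theorem LeadsTo.reaches {a b : V} (h : G.LeadsTo b a) : G.Reaches a b := by
  induction h with
  | base => exact ⟨[], rfl⟩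
  | step a hne _ ih =>
    obtain ⟨e, he⟩ := hne
    obtain ⟨p, hp⟩ := ih e he
    exact ⟨e :: p, he, hp⟩

/-- `LeadsTo` is an inductive predicate, hence well-founded: each edge of `f` passes to a smaller
derivation until `base` is reached. -/
theorem LeadsTo.exists_source_eq {a b : V} (h : G.LeadsTo b a) (f : ℕ → E)
    (hf : G.IsInfinitePath f) (h0 : G.s (f 0) = a) : ∃ N, G.s (f N) = b := by
  induction h generalizing f with
  | base => exact ⟨0, h0⟩
  | step a hne _ ih =>
    obtain ⟨N, hN⟩ := ih (f 0) h0 (fun i => f (i + 1)) (fun i => hf (i + 1)) (hf 0).symm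
    exact ⟨N + 1, hN⟩

theorem IsPath.range_getElem {a b : V} {p : List E} (h : G.IsPath a p b) (i : ℕ)
    (hi : i + 1 < p.length) : G.r p[i] = G.s p[i + 1] := by
  induction p generalizing a i with
  | nil => simp at hi
  | cons e p ih =>
    cases i with
    | zero =>
      cases p with
      | nil => simp at hi
      | cons f p => exact h.2.1.symm
    | succ i => exact ih h.2 i (by simpa using hi)

theorem IsPath.source_getElem_zero {a b : V} {p : List E} (h : G.IsPath a p b)
    (hi : 0 < p.length) : G.s p[0] = a := by
  cases p with
  | nil => simp at hi
  | cons e p => exact h.1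

theorem IsPath.range_getElem_last {a b : V} {p : List E} (h : G.IsPath a p b) (i : ℕ)
    (hi : i + 1 = p.length) : G.r p[i] = b := by
  induction p generalizing a i with
  | nil => simp at hi
  | cons e p ih =>
    cases i with
    | zero =>
      obtain rfl : p = [] := by simpa using hi
      exact h.2
    | succ i => exact ih h.2 i (by simpa using hi)

/-- The edges of a closed path follow one another cyclically. -/
theorem IsPath.range_getElem_mod {b : V} {γ : List E} (h : G.IsPath b γ b) (hpos : 0 < γ.length)
    (i : ℕ) : G.r (γ[i % γ.length]'(Nat.mod_lt _ hpos)) =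
      G.s (γ[(i + 1) % γ.length]'(Nat.mod_lt _ hpos)) := by
  have hlt := Nat.mod_lt i hpos
  by_cases hi : i % γ.length + 1 < γ.length
  · rw [h.range_getElem _ hi]
    have : (i + 1) % γ.length = i % γ.length + 1 := by
      rw [Nat.add_mod, Nat.mod_eq_of_lt (a := 1) (by omega), Nat.mod_eq_of_lt hi]
    simp only [this]
  · have hlast : i % γ.length + 1 = γ.length := by omega
    rw [h.range_getElem_last _ hlast]
    have : (i + 1) % γ.length = 0 := by
      rw [← Nat.mod_add_mod, hlast, Nat.mod_self]
    simp only [this]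
    exact (h.source_getElem_zero hpos).symm

/-- Once at `b`, an infinite path has no choice, as every vertex on `γ` emits a single edge. -/
theorem eq_getElem_of_isInfinitePath {b : V} {γ : List E} (hc : G.IsPath b γ b)
    (hpos : 0 < γ.length) (hexit : G.HasNoExit γ) {f : ℕ → E} (hf : G.IsInfinitePath f) {N : ℕ}
    (hN : G.s (f N) = b) (i : ℕ) : f (N + i) = γ[i % γ.length]'(Nat.mod_lt _ hpos) := by
  refine hexit _ (List.getElem_mem _) _ ?_
  induction i with
  | zero =>
    simp only [Nat.zero_mod]
    rw [hc.source_getElem_zero hpos]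
    exact hN
  | succ i ih =>
    rw [← add_assoc, ← hf, hexit _ (List.getElem_mem _) _ ih, hc.range_getElem_mod hpos]

/-- Since the entries of each list are distinct, its length is the exact period of its periodic
repetition. The two repetitions agree up to a shift, so each length divides the other. -/
theorem isRotated_of_getElem_mod {γ d : List E} (hc : (γ.map G.s).Nodup) (hd : (d.map G.s).Nodup)
    (hcpos : 0 < γ.length) (hdpos : 0 < d.length) (N : ℕ)
    (h : ∀ i : ℕ, d[(N + i) % d.length]'(Nat.mod_lt _ hdpos) =
      γ[i % γ.length]'(Nat.mod_lt _ hcpos)) : d ~r γ := by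
  have hc' := hc.of_map
  have hd' : (d.rotate N).Nodup := List.nodup_rotate.2 hd.of_map
  have hrot : ∀ (i : ℕ) (hi : i < (d.rotate N).length),
      (d.rotate N)[i] = γ[i % γ.length]'(Nat.mod_lt _ hcpos) := by
    intro i hi
    rw [List.getElem_rotate, ← h]
    simp only [add_comm]
  have h₁ : γ.length % d.length = 0 := by
    have h0 := h γ.length
    have h1 := h 0
    simp only [Nat.mod_self] at h0
    simp only [Nat.zero_mod, ← h0] at h1
    have := (hd.of_map.getElem_inj_iff).1 h1
    have : N + 0 ≡ N + γ.length [MOD d.length] := this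
    exact (Nat.ModEq.add_left_cancel' N this).symm
  have h₂ : d.length % γ.length = 0 := by
    have h0 := h d.length
    have h1 := h 0
    simp only [Nat.add_mod_right] at h0
    simp only [Nat.add_zero, h0] at h1
    have := (hc'.getElem_inj_iff).1 h1
    simpa using this
  have hlen : d.length = γ.length :=
    Nat.dvd_antisymm (Nat.dvd_of_mod_eq_zero h₁) (Nat.dvd_of_mod_eq_zero h₂)
  refine ⟨N, List.ext_getElem (by simpa using hlen) fun i hi hi' => ?_⟩
  rw [hrot i hi]
  simp only [Nat.mod_eq_of_lt hi']

/-- If every vertex leads to a cycle without exits, the graph is a comet. -/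
theorem isComet_of_leadsTo {b : V} {γ : List E} (hc : G.IsPath b γ b) (hcyc : G.IsCycle γ)
    (hexit : G.HasNoExit γ) (h : ∀ a, G.LeadsTo b a) : G.IsComet := by
  have hpos : 0 < γ.length := List.length_pos_iff.2 hcyc.1
  have hmem : ∀ f, G.IsInfinitePath f → ∃ N, ∀ i,
      f (N + i) = γ[i % γ.length]'(Nat.mod_lt _ hpos) := by
    intro f hf
    obtain ⟨N, hN⟩ := (h (G.s (f 0))).exists_source_eq f hf rfl
    exact ⟨N, eq_getElem_of_isInfinitePath hc hpos hexit hf hN⟩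
  refine ⟨γ, hcyc, fun d hd => ?_, fun a => ⟨b, (h a).reaches, ?_⟩, fun f hf => ?_⟩
  · obtain ⟨hne, ⟨a, ha⟩, hnd⟩ := hd
    have hdpos : 0 < d.length := List.length_pos_iff.2 hne
    -- The cycle `d` repeated forever is an infinite path, so it eventually runs along `γ`.
    obtain ⟨N, hN⟩ := hmem (fun i => d[i % d.length]'(Nat.mod_lt _ hdpos))
      (fun i => ha.range_getElem_mod hdpos i)
    exact isRotated_of_getElem_mod hcyc.2.2 hnd hpos hdpos N hN
  · exact ⟨γ[0], List.getElem_mem _, Or.inl (hc.source_getElem_zero hpos)⟩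
  · obtain ⟨N, hN⟩ := hmem f hf
    exact ⟨N, fun i => by rw [hN, List.getElem?_eq_getElem]⟩

end DirectedGraph

/-! ### Laurent polynomials in a corner -/

/-- Mutually inverse elements `c` and `d` of the corner of an idempotent `b`. -/
structure IsCornerUnit {A : Type*} [NonUnitalRing A] (b c d : A) : Prop where
  idem : b * b = b
  left_mul : b * c = c
  mul_right : c * b = c
  left_mul_inv : b * d = d
  inv_mul_right : d * b = d
  mul_inv : c * d = b
  inv_mul : d * c = b

section CornerPow

variable {A : Type*} [NonUnitalRing A]

/-- The integral powers of a unit of a corner. -/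
def cornerPow (b c d : A) : ℤ → A
  | .ofNat n => (c * ·)^[n] b
  | .negSucc n => (d * ·)^[n + 1] b

variable {b c d : A} (h : IsCornerUnit b c d)

include h

theorem corner_mul_cornerPow (n : ℤ) : b * cornerPow b c d n = cornerPow b c d n := by
  rcases n with (_ | n) | n
  · exact h.idem
  · simp only [cornerPow, Function.iterate_succ_apply']
    rw [← mul_assoc, h.left_mul]
  · simp only [cornerPow, Function.iterate_succ_apply']
    rw [← mul_assoc, h.left_mul_inv]

theorem cornerPow_add_one (n : ℤ) : cornerPow b c d (n + 1) = c * cornerPow b c d n := by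
  rcases n with n | n
  · exact Function.iterate_succ_apply' _ n b
  · have hn : cornerPow b c d (Int.negSucc n) = d * cornerPow b c d (Int.negSucc n + 1) := by
      cases n with
      | zero => rfl
      | succ n => exact Function.iterate_succ_apply' _ (n + 1) b
    rw [hn, ← mul_assoc, h.mul_inv, corner_mul_cornerPow h]

theorem cornerPow_sub_one (n : ℤ) : cornerPow b c d (n - 1) = d * cornerPow b c d n := by
  conv_rhs => rw [← sub_add_cancel n 1, cornerPow_add_one h, ← mul_assoc, h.inv_mul,
    corner_mul_cornerPow h]

theorem cornerPow_add (m n : ℤ) :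
    cornerPow b c d (m + n) = cornerPow b c d m * cornerPow b c d n := by
  induction m using Int.induction_on with
  | zero => rw [zero_add]; exact (corner_mul_cornerPow h n).symm
  | succ m ih => rw [add_right_comm, cornerPow_add_one h, ih, cornerPow_add_one h, mul_assoc]
  | pred m ih => rw [sub_add_eq_add_sub, cornerPow_sub_one h, ih, cornerPow_sub_one h, mul_assoc]

theorem cornerPow_one : cornerPow b c d 1 = c := h.mul_right

theorem cornerPow_neg_one : cornerPow b c d (-1) = d := h.inv_mul_right

noncomputable section

/-- The homomorphism from the Laurent polynomials given by a unit of a corner. -/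
def cornerLift (K : Type*) [CommRing K] [Module K A] [IsScalarTower K A A] [SMulCommClass K A A] :
    LaurentPolynomial K →ₙₐ[K] A :=
  AddMonoidAlgebra.liftMagma K
    { toFun := fun n => cornerPow b c d n.toAdd
      map_mul' := fun m n => cornerPow_add h m.toAdd n.toAdd }

theorem cornerLift_single (K : Type*) [CommRing K] [Module K A] [IsScalarTower K A A]
    [SMulCommClass K A A] (n : ℤ) (k : K) :
    cornerLift h K (AddMonoidAlgebra.single n k) = k • cornerPow b c d n := by
  simp [cornerLift, AddMonoidAlgebra.liftMagma_apply_apply, -LaurentPolynomial.single_eq_C_mul_T]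

theorem cornerLift_one (K : Type*) [CommRing K] [Module K A] [IsScalarTower K A A]
    [SMulCommClass K A A] : cornerLift h K 1 = b :=
  (cornerLift_single h K 0 1).trans (one_smul K b)

end

end CornerPow

/-! ### Matrix units -/

namespace FinMatrix

noncomputable section

variable {Λ : Type v} {R : Type w} [CommRing R]

/-- The matrix with the only entry `r` at the position `(i, j)`. -/
def single (i j : Λ) (r : R) : FinMatrix Λ R := show Λ × Λ →₀ R from Finsupp.single (i, j) r

open scoped Classical in
theorem entry_single (i j k l : Λ) (r : R) :
    (single i j r).entry k l = if i = k ∧ j = l then r else 0 := by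
  refine (Finsupp.single_apply (a := (i, j)) (a' := (k, l))).trans (if_congr ?_ rfl rfl)
  exact Prod.mk_inj

theorem entry_smul {K : Type u} [CommRing K] [Module K R] (k : K) (A : FinMatrix Λ R) (i j : Λ) :
    (k • A).entry i j = k • A.entry i j := rfl

theorem induction_linear {p : FinMatrix Λ R → Prop} (A : FinMatrix Λ R) (zero : p 0)
    (add : ∀ A B, p A → p B → p (A + B)) (single : ∀ i j r, p (single i j r)) : p A :=
  Finsupp.induction_linear (show Λ × Λ →₀ R from A) zero add fun ij r => single ij.1 ij.2 r

theorem cols_single_subset (i j : Λ) (r : R) : (single i j r).cols ⊆ {j} := by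
  classical
  intro l hl
  by_contra hne
  obtain ⟨⟨k, l'⟩, hkl, rfl⟩ := Finset.mem_image.1 hl
  refine Finsupp.mem_support_iff.1 hkl ?_
  have := entry_single i j k l' r
  rw [if_neg fun h => hne (Finset.mem_singleton.2 h.2.symm)] at this
  exact this

theorem entry_single_mul (i j k l : Λ) (r : R) (A : FinMatrix Λ R) [Decidable (i = k)] :
    (single i j r * A).entry k l = if i = k then r * A.entry j l else 0 := by
  classical
  rw [entry_mul_of_subset _ _ _ _ _ (cols_single_subset i j r), Finset.sum_singleton, entry_single]
  by_cases h : i = k <;> simp [h]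

theorem entry_mul_single (i j k l : Λ) (r : R) (A : FinMatrix Λ R) [Decidable (j = l)] :
    (A * single i j r).entry k l = if j = l then A.entry k i * r else 0 := by
  classical
  rw [entry_mul_of_subset _ _ _ _ (insert i A.cols) (Finset.subset_insert _ _),
    Finset.sum_eq_single_of_mem i (Finset.mem_insert_self _ _)]
  · rw [entry_single]
    by_cases h : j = l <;> simp [h]
  · intro m _ hm
    rw [entry_single, if_neg fun h => hm h.1.symm, mul_zero]

theorem single_mul_single_same (i j k : Λ) (r s : R) :
    single i j r * single j k s = single i k (r * s) := by
  classical
  ext a b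
  rw [entry_single_mul, entry_single, entry_single]
  by_cases h : i = a <;> by_cases h' : k = b <;> simp [h, h']

theorem single_mul_single_of_ne (i j k l : Λ) (r s : R) (h : j ≠ k) :
    single i j r * single k l s = 0 := by
  classical
  ext a b
  rw [entry_single_mul]
  simp [entry_single, h.symm, entry_zero]

section MatrixUnits

variable {K : Type u} [CommRing K] [Algebra K R] {A : Type*} [NonUnitalRing A] [Module K A]
  [IsScalarTower K A A] [SMulCommClass K A A] (P Q : Λ → A) (θ : R →ₙₐ[K] A)

/-- The linear map which sends the matrix unit at `(i, j)` with entry `r` to `P i * θ r * Q j`. -/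
def unitsLift : FinMatrix Λ R →ₗ[K] A :=
  show (Λ × Λ →₀ R) →ₗ[K] A from
    Finsupp.lsum K fun ij => LinearMap.mulRight K (Q ij.2) ∘ₗ LinearMap.mulLeft K (P ij.1) ∘ₗ
      (θ : R →ₗ[K] A)

theorem unitsLift_single (i j : Λ) (r : R) :
    unitsLift P Q θ (single i j r) = P i * θ r * Q j :=
  Finsupp.lsum_single _ _ _ _

variable (h₁ : ∀ i, Q i * P i = θ 1) (h₂ : ∀ i j, i ≠ j → Q i * P j = 0)

include h₁ h₂

/-- Between the images of two matrix units stands `Q j * P k`, which is `θ 1` or `0`; this is the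
multiplication rule of matrix units. -/
theorem unitsLift_mul (M N : FinMatrix Λ R) :
    unitsLift P Q θ (M * N) = unitsLift P Q θ M * unitsLift P Q θ N := by
  induction M using induction_linear with
  | zero => rw [zero_mul, map_zero, zero_mul]
  | add M M' hM hM' => rw [add_mul, map_add, map_add, add_mul, hM, hM']
  | single i j r =>
    induction N using induction_linear with
    | zero => rw [mul_zero, map_zero, mul_zero]
    | add N N' hN hN' => rw [mul_add, map_add, map_add, mul_add, hN, hN']
    | single k l s =>
      have hassoc : P i * θ r * Q j * (P k * θ s * Q l) =
          P i * (θ r * (Q j * P k) * θ s) * Q l := by simp only [mul_assoc]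
      rw [unitsLift_single, unitsLift_single, hassoc]
      by_cases hjk : j = k
      · subst hjk
        rw [h₁, single_mul_single_same, unitsLift_single, ← map_mul, ← map_mul, mul_one]
      · rw [h₂ j k hjk, single_mul_single_of_ne _ _ _ _ _ _ hjk, map_zero, mul_zero, zero_mul,
          mul_zero, zero_mul]

/-- Compressing by `Q i` and `P j` isolates one entry, so injectivity of `θ` passes to `unitsLift`.
-/
theorem mul_unitsLift_mul (M : FinMatrix Λ R) (i j : Λ) :
    Q i * unitsLift P Q θ M * P j = θ (M.entry i j) := by
  classical
  induction M using induction_linear with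
  | zero => rw [map_zero, mul_zero, zero_mul, entry_zero, map_zero]
  | add M M' hM hM' => rw [map_add, mul_add, add_mul, hM, hM', entry_add, map_add]
  | single k l r =>
    have hassoc : Q i * (P k * θ r * Q l) * P j = Q i * P k * θ r * (Q l * P j) := by
      simp only [mul_assoc]
    rw [unitsLift_single, hassoc, entry_single]
    by_cases hk : k = i
    · subst hk
      by_cases hl : l = j
      · subst hl
        rw [h₁, h₁, ← map_mul, ← map_mul, one_mul, mul_one, if_pos ⟨rfl, rfl⟩]
      · rw [h₂ l j hl, mul_zero, if_neg fun h => hl h.2, map_zero]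
    · rw [h₂ i k (Ne.symm hk), zero_mul, zero_mul, if_neg fun h => hk h.1, map_zero]

theorem unitsLift_injective (hθ : Function.Injective θ) :
    Function.Injective (unitsLift P Q θ) := by
  intro M N h
  ext i j
  apply hθ
  rw [← mul_unitsLift_mul P Q θ h₁ h₂, h, mul_unitsLift_mul P Q θ h₁ h₂]

end MatrixUnits

/-! ### The centroid of a matrix algebra -/

section Centroid

variable {K : Type u} [CommRing K] [Algebra K R]

instance : IsScalarTower K (FinMatrix Λ R) (FinMatrix Λ R) where
  smul_assoc k A B := by
    induction A using induction_linear with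
    | zero => simp
    | add A A' hA hA' =>
      simp only [smul_eq_mul] at hA hA' ⊢
      rw [smul_add, add_mul, add_mul, smul_add, hA, hA']
    | single i j r =>
      classical
      have hs : k • single i j r = single i j (k • r) := by
        ext a b
        rw [entry_smul, entry_single, entry_single, smul_ite, smul_zero]
      ext a b
      rw [smul_eq_mul, smul_eq_mul, hs, entry_smul, entry_single_mul, entry_single_mul, smul_ite,
        smul_zero, smul_mul_assoc]

instance : SMulCommClass K (FinMatrix Λ R) (FinMatrix Λ R) where
  smul_comm k A B := by
    ext i j
    simp only [smul_eq_mul, entry_mul, entry_smul, mul_smul_comm, Finset.smul_sum]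

instance : IsScalarTower K R (FinMatrix Λ R) where
  smul_assoc k r A := by
    ext i j
    simp only [entry_smul, smul_assoc]

variable (Λ R K) in
/-- The action of the scalars on the matrices is central. -/
def scalarCentroid : R →ₐ[K] centroid K (FinMatrix Λ R) :=
  (Algebra.lsmul K K (FinMatrix Λ R) : R →ₐ[K] Module.End K (FinMatrix Λ R)).codRestrict _
    fun r A B => ⟨(smul_mul_assoc r A B).symm, (mul_smul_comm r A B).symm⟩

theorem scalarCentroid_apply (r : R) (A : FinMatrix Λ R) :
    (scalarCentroid Λ R K r : Module.End K (FinMatrix Λ R)) A = r • A := rfl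

/-- Write `E i j` for matrix units. For `τ` in the centroid, `τ (E i i) = E i i * τ (E i i)` leaves
only row `i`, and right multiplication by `E i j` leaves only column `j`, so `τ` scales `E i j` by
some `c i`. Taking `τ` through the right factor of `E i j * E j j` gives `c i = c j`. -/
theorem scalarCentroid_bijective [Nonempty Λ] : Function.Bijective (scalarCentroid Λ R K) := by
  classical
  obtain ⟨o⟩ := ‹Nonempty Λ›
  constructor
  · intro r s h
    have := congrArg (fun τ : centroid K (FinMatrix Λ R) =>
      ((τ : Module.End K (FinMatrix Λ R)) (single o o 1)).entry o o) h
    simpa only [scalarCentroid_apply, entry_smul, entry_single, and_self, if_true, smul_eq_mul,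
      mul_one] using this
  · rintro ⟨τ, hτ⟩
    set c : Λ → R := fun i => (τ (single i i 1)).entry i i with hc
    have hl : ∀ i j (r : R), τ (single i j r) = single i j (c i * r) := by
      intro i j r
      have h₁ : τ (single i j r) = τ (single i i 1) * single i j r := by
        rw [← (hτ _ _).1, single_mul_single_same, one_mul]
      have h₂ : τ (single i i 1) = single i i 1 * τ (single i i 1) := by
        rw [← (hτ _ _).2, single_mul_single_same, one_mul]
      rw [h₁, h₂]
      ext a b
      rw [entry_mul_single, entry_single_mul, entry_single]
      by_cases ha : i = a <;> by_cases hb : j = b <;> simp [ha, hb, hc]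
    have hr : ∀ i j, c i = c j := by
      intro i j
      have h : τ (single i j 1) = single i j 1 * τ (single j j 1) := by
        rw [← (hτ _ _).2, single_mul_single_same, one_mul]
      rw [hl, hl, single_mul_single_same] at h
      have h' := congrArg (fun A => A.entry i j) h
      simpa only [entry_single, and_self, if_true, mul_one, one_mul] using h'
    refine ⟨c o, Subtype.ext (LinearMap.ext fun A => ?_)⟩
    rw [scalarCentroid_apply]
    induction A using induction_linear with
    | zero => rw [smul_zero, map_zero]
    | add A B hA hB => rw [smul_add, map_add, hA, hB]
    | single i j r =>
      rw [hl, hr i o]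
      ext a b
      rw [entry_smul, entry_single, entry_single, smul_ite, smul_zero, smul_eq_mul]

end Centroid

end

end FinMatrix

/-- Isomorphic algebras have isomorphic centroids. -/
theorem nonempty_centroid_algEquiv {K A B : Type*} [CommRing K] [NonUnitalRing A] [Module K A]
    [IsScalarTower K A A] [SMulCommClass K A A] [NonUnitalRing B] [Module K B]
    [IsScalarTower K B B] [SMulCommClass K B B] (e : A ≃ₗ[K] B)
    (he : ∀ x y, e (x * y) = e x * e y) : Nonempty (centroid K A ≃ₐ[K] centroid K B) := by
  have hsymm : ∀ x y, e.symm (x * y) = e.symm x * e.symm y := by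
    intro x y
    apply e.injective
    simp [he]
  refine ⟨((e.conjAlgEquiv K).subalgebraMap (centroid K A)).trans (Subalgebra.equivOfEq _ _ ?_)⟩
  ext τ
  constructor
  · rintro ⟨σ, hσ, rfl⟩ x y
    constructor
    · simp [hsymm, (hσ _ _).1, he]
    · simp [hsymm, (hσ _ _).2, he]
  · intro hτ
    refine ⟨(e.conjAlgEquiv K).symm τ, fun x y => ⟨?_, ?_⟩, (e.conjAlgEquiv K).apply_symm_apply τ⟩
    · apply e.injective
      simp [(hτ _ _).1, he]
    · apply e.injective
      simp [(hτ _ _).2, he]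

/-! ### The corner at a cycle without exits -/

namespace LeavittPathAlgebra

open DirectedGraph

section CycleCorner

variable {K : Type w} [Field K] {V : Type u} {E : Type v} {G : DirectedGraph V E}

theorem edge_mul_ghost_of_unique {e : E} (h : ∀ f, G.s f = G.s e → f = e) :
    edge K G e * ghost K G e = vertex K G (G.s e) := by
  rw [vertex_eq_sum K G (G.s e) {e} (fun f => ?_) (Finset.singleton_nonempty e),
    Finset.sum_singleton]
  rw [Finset.mem_singleton]
  exact ⟨fun hf => hf ▸ rfl, h f⟩

/-- The product telescopes from the middle: (CK2) has a single summand at each source, so every `e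
e*` is a vertex. -/
theorem pathElem_mul_ghostElem {a d : V} {p : List E} (hp : G.IsPath a p d)
    (hexit : G.HasNoExit p) : pathElem K G a p * ghostElem K G a p = vertex K G a := by
  induction p generalizing a with
  | nil => exact vertex_mul_self K G a
  | cons e p ih =>
    have hassoc : pathElem K G a (e :: p) * ghostElem K G a (e :: p) = edge K G e *
        (pathElem K G (G.r e) p * ghostElem K G (G.r e) p) * ghost K G e := by
      simp only [pathElem, ghostElem, mul_assoc]
    rw [hassoc, ih hp.2 fun f hf => hexit f (List.mem_cons_of_mem _ hf), edge_mul_range,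
      edge_mul_ghost_of_unique (hexit e List.mem_cons_self), hp.1]

theorem isCornerUnit_cycle {b : V} {γ : List E} (hγ : G.IsPath b γ b) (hexit : G.HasNoExit γ) :
    IsCornerUnit (vertex K G b) (pathElem K G b γ) (ghostElem K G b γ) where
  idem := vertex_mul_self K G b
  left_mul := vertex_mul_pathElem hγ
  mul_right := pathElem_mul_vertex hγ
  left_mul_inv := vertex_mul_ghostElem hγ
  inv_mul_right := ghostElem_mul_vertex hγ
  mul_inv := pathElem_mul_ghostElem hγ hexit
  inv_mul := ghostElem_mul_pathElem_self hγ

/-! ### Linear independence of the powers of the cycle -/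

section Injective

variable {X : Type*} (B : G.BranchingSystem X)

noncomputable section

/-- The indicator function of the fibre of a vertex. -/
def fibreIndicator (R : Type*) [CommRing R] (a : V) : X → R :=
  open scoped Classical in fun x => if B.src x = a then 1 else 0

open LaurentPolynomial

/-- The unit `T` of the Laurent polynomials. -/
def unitT (K : Type*) [CommRing K] : K[T;T⁻¹]ˣ where
  val := T 1
  inv := T (-1)
  val_inv := by rw [← T_add]; rfl
  inv_val := by rw [← T_add]; rfl

variable (K) in
/-- The representation on functions with values in the Laurent polynomials in which the element
`α β*` has degree `|α| - |β|`. -/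
def laurentRep : LeavittPathAlgebra K G →ₙₐ[K] Module.End K[T;T⁻¹] (X → K[T;T⁻¹]) :=
  lift (isFamily_branching B (unitT K))

theorem laurentRep_vertex (a : V) : laurentRep K B (vertex K G a) (fibreIndicator B _ a) =
    fibreIndicator B K[T;T⁻¹] a := by
  funext x
  rw [laurentRep, lift_vertex, vertexOp_apply, fibreIndicator]
  split_ifs <;> rfl

/-- As `e` is the only edge at its source, every point of the fibre over `G.s e` has head `e`, so no
part of that fibre is lost. -/
theorem laurentRep_edge {e : E} (h : ∀ f, G.s f = G.s e → f = e) :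
    laurentRep K B (edge K G e) (fibreIndicator B _ (G.r e)) =
      (T 1 : K[T;T⁻¹]) • fibreIndicator B _ (G.s e) := by
  funext x
  rw [laurentRep, lift_edge, edgeOp_apply, Pi.smul_apply]
  by_cases hx : B.head x = some e
  · rw [if_pos hx, fibreIndicator, if_pos (B.src_tail hx), fibreIndicator,
      if_pos (B.source_head hx).symm]
    rfl
  · rw [if_neg hx, fibreIndicator, if_neg, smul_zero]
    intro hs
    cases hh : B.head x with
    | none => exact B.ne_source hh e hs.symm
    | some f => exact hx (by rw [hh, h f ((B.source_head hh).trans hs)])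

theorem laurentRep_pathElem {a d : V} {p : List E} (hp : G.IsPath a p d)
    (hexit : G.HasNoExit p) : laurentRep K B (pathElem K G a p) (fibreIndicator B _ d) =
      (T p.length : K[T;T⁻¹]) • fibreIndicator B _ a := by
  induction p generalizing a with
  | nil =>
    obtain rfl : a = d := hp
    rw [pathElem, laurentRep_vertex, List.length_nil, Nat.cast_zero, T_zero, one_smul]
  | cons e p ih =>
    rw [pathElem, map_mul, Module.End.mul_apply,
      ih hp.2 fun f hf => hexit f (List.mem_cons_of_mem _ hf), map_smul,
      laurentRep_edge B (hexit e List.mem_cons_self), smul_smul, ← T_add, hp.1, List.length_cons]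
    push_cast
    rfl

/-- The indicator of the fibre is an eigenvector of `γ` with eigenvalue `T` to the length of `γ`.
Since `γ* γ = b` fixes it, `γ*` has the inverse eigenvalue. -/
theorem laurentRep_cornerPow {b : V} {γ : List E} (hγ : G.IsPath b γ b) (hexit : G.HasNoExit γ)
    (n : ℤ) : laurentRep K B (cornerPow (vertex K G b) (pathElem K G b γ) (ghostElem K G b γ) n)
      (fibreIndicator B _ b) = (T (n * γ.length) : K[T;T⁻¹]) • fibreIndicator B _ b := by
  have h := isCornerUnit_cycle (K := K) hγ hexit
  have hghost : laurentRep K B (ghostElem K G b γ) (fibreIndicator B _ b) =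
      (T (-γ.length) : K[T;T⁻¹]) • fibreIndicator B _ b := by
    have h1 := congrArg (laurentRep K B) h.inv_mul
    have h2 := LinearMap.congr_fun h1 (fibreIndicator B _ b)
    rw [map_mul, Module.End.mul_apply, laurentRep_pathElem B hγ hexit, map_smul,
      laurentRep_vertex] at h2
    conv_rhs => rw [← h2, smul_smul, ← T_add, neg_add_cancel, T_zero, one_smul]
  induction n using Int.induction_on with
  | zero => rw [zero_mul, T_zero, one_smul]; exact laurentRep_vertex B b
  | succ n ih =>
    rw [cornerPow_add_one h, map_mul, Module.End.mul_apply, ih, map_smul,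
      laurentRep_pathElem B hγ hexit, smul_smul, ← T_add, add_mul, one_mul]
  | pred n ih =>
    rw [cornerPow_sub_one h, map_mul, Module.End.mul_apply, ih, map_smul, hghost, smul_smul,
      ← T_add, sub_mul, one_mul, sub_eq_add_neg]

/-- A Laurent polynomial `f` acts on the indicator as multiplication by `f(T^ℓ)`, where `ℓ` is the
length of `γ`. As `ℓ ≠ 0`, this substitution is injective, and evaluation at a point over `b`
recovers the result. -/
theorem cornerLift_injective (hrow : G.RowFinite) {b : V} {γ : List E} (hγ : G.IsPath b γ b)
    (hne : γ ≠ []) (hexit : G.HasNoExit γ) :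
    Function.Injective (cornerLift (isCornerUnit_cycle (K := K) hγ hexit) K) := by
  obtain ⟨B, hB⟩ := exists_branchingSystem (H := ∅) hrow
    ⟨fun _ h => h, fun a ⟨e, he⟩ h => h e he⟩
  have key : ∀ f : K[T;T⁻¹], laurentRep K B (cornerLift (isCornerUnit_cycle hγ hexit) K f)
      (fibreIndicator B _ b) =
        AddMonoidAlgebra.mapDomain (fun n : ℤ => n * γ.length) f • fibreIndicator B _ b := by
    intro f
    induction f using AddMonoidAlgebra.induction_linear with
    | zero => rw [map_zero, map_zero, AddMonoidAlgebra.mapDomain_zero, zero_smul]; rfl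
    | add f g hf hg =>
      rw [map_add, map_add, AddMonoidAlgebra.mapDomain_add, add_smul, ← hf, ← hg]
      rfl
    | single n k =>
      rw [cornerLift_single, map_smul, LinearMap.smul_apply, laurentRep_cornerPow B hγ hexit,
        AddMonoidAlgebra.mapDomain_single, ← smul_assoc, T, AddMonoidAlgebra.smul_single,
        smul_eq_mul, mul_one]
  intro f g hfg
  have h := congrFun ((key f).symm.trans ((congrArg (fun x => laurentRep K B x
    (fibreIndicator B _ b)) hfg).trans (key g))) (⟨b, fun h => h⟩, 0)
  rw [Pi.smul_apply, Pi.smul_apply, fibreIndicator, if_pos (hB _), smul_eq_mul, smul_eq_mul,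
    mul_one, mul_one] at h
  refine AddMonoidAlgebra.mapDomain_injective (fun m n hmn => ?_) h
  have : (γ.length : ℤ) ≠ 0 := by simpa using hne
  exact mul_right_cancel₀ this hmn

end

end Injective

/-! ### First paths and the matrix decomposition -/

section Span

/-- The paths which arrive at `b` for the first time at their end. -/
@[ext]
structure FirstPath (G : DirectedGraph V E) (b : V) : Type v where
  path : List E
  exists_isPath : ∃ a, G.IsPath a path b
  source_ne : ∀ e ∈ path, G.s e ≠ b

/-- The source of a path with range `b`. -/
def listSource (G : DirectedGraph V E) (b : V) : List E → V
  | [] => b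
  | e :: _ => G.s e

theorem isPath_listSource {b : V} (p : FirstPath G b) : G.IsPath (listSource G b p.path) p.path b := by
  obtain ⟨p, ⟨a, ha⟩, _⟩ := p
  cases p with
  | nil => rfl
  | cons e p => exact ⟨rfl, ha.2⟩

theorem listSource_eq {a b : V} {p : List E} (hp : G.IsPath a p b) : listSource G b p = a := by
  cases p with
  | nil => exact Eq.symm hp
  | cons e p => exact hp.1

noncomputable section

variable (K) in
/-- A path which arrives at `b` for the first time at its end, as an element of the algebra. -/
def firstElem {b : V} (p : FirstPath G b) : LeavittPathAlgebra K G :=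
  pathElem K G (listSource G b p.path) p.path

variable (K) in
/-- The ghost of a path which arrives at `b` for the first time at its end. -/
def firstGhost {b : V} (p : FirstPath G b) : LeavittPathAlgebra K G :=
  ghostElem K G (listSource G b p.path) p.path

theorem firstElem_eq {a b : V} {p : FirstPath G b} (hp : G.IsPath a p.path b) :
    firstElem K p = pathElem K G a p.path := by
  rw [firstElem, listSource_eq hp]

theorem firstGhost_eq {a b : V} {p : FirstPath G b} (hp : G.IsPath a p.path b) :
    firstGhost K p = ghostElem K G a p.path := by
  rw [firstGhost, listSource_eq hp]

theorem firstGhost_mul_firstElem_self {b : V} (p : FirstPath G b) :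
    firstGhost K p * firstElem K p = vertex K G b :=
  ghostElem_mul_pathElem_self (isPath_listSource p)

/-- Neither path is a proper initial segment of the other, since the longer one would visit `b`
before its end. So the sources differ or two edges at the same place do. -/
theorem ghostElem_mul_pathElem_of_ne {a a' b : V} {p q : List E} (hp : G.IsPath a p b)
    (hq : G.IsPath a' q b) (hpb : ∀ e ∈ p, G.s e ≠ b) (hqb : ∀ e ∈ q, G.s e ≠ b) (hne : p ≠ q) :
    ghostElem K G a p * pathElem K G a' q = 0 := by
  induction p generalizing a a' q with
  | nil =>
    obtain rfl : a = b := hp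
    cases q with
    | nil => exact absurd rfl hne
    | cons f q =>
      rw [ghostElem]
      refine vertex_mul_pathElem_of_ne hq fun h => hqb f List.mem_cons_self ?_
      rw [h, hq.1]
  | cons e p ih =>
    cases q with
    | nil =>
      obtain rfl : a' = b := hq
      rw [pathElem]
      refine ghostElem_mul_vertex_of_ne hp fun h => hpb e List.mem_cons_self ?_
      rw [h, hp.1]
    | cons f q =>
      rw [ghostElem, pathElem, mul_assoc, ← mul_assoc (ghost K G e)]
      by_cases hef : e = f
      · subst hef
        rw [ghost_mul_edge_self, vertex_mul_pathElem hq.2]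
        exact ih hp.2 hq.2 (fun g hg => hpb g (List.mem_cons_of_mem _ hg))
          (fun g hg => hqb g (List.mem_cons_of_mem _ hg)) fun h => hne (h ▸ rfl)
      · rw [ghost_mul_edge_of_ne K G hef, zero_mul, mul_zero]

theorem firstGhost_mul_firstElem_of_ne {b : V} (p q : FirstPath G b) (h : p ≠ q) :
    firstGhost K p * firstElem K q = 0 :=
  ghostElem_mul_pathElem_of_ne (isPath_listSource p) (isPath_listSource q) p.source_ne q.source_ne
    fun h' => h (FirstPath.ext h')

/-- First returns along edges without exits are unique. -/
theorem eq_of_hasNoExit {a b : V} {p q : List E} (hp : G.IsPath a p b) (hq : G.IsPath a q b)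
    (hpb : ∀ e ∈ p, G.s e ≠ b) (hqb : ∀ e ∈ q, G.s e ≠ b) (hexit : G.HasNoExit q) : p = q := by
  induction p generalizing a q with
  | nil =>
    obtain rfl : a = b := hp
    cases q with
    | nil => rfl
    | cons f q => exact absurd hq.1 (hqb f List.mem_cons_self)
  | cons e p ih =>
    cases q with
    | nil =>
      obtain rfl : a = b := hq
      exact absurd hp.1 (hpb e List.mem_cons_self)
    | cons f q =>
      obtain rfl : e = f := hexit f List.mem_cons_self e (hp.1.trans hq.1.symm)
      rw [ih hp.2 hq.2 (fun g hg => hpb g (List.mem_cons_of_mem _ hg))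
        (fun g hg => hqb g (List.mem_cons_of_mem _ hg))
        fun g hg => hexit g (List.mem_cons_of_mem _ hg)]

variable (K) in
/-- The powers of a cycle `γ` at `b`. -/
def cyclePow (G : DirectedGraph V E) (b : V) (γ : List E) : ℤ → LeavittPathAlgebra K G :=
  cornerPow (vertex K G b) (pathElem K G b γ) (ghostElem K G b γ)

variable (K) in
/-- The span of the elements `p γⁿ` for first paths `p`. -/
def firstSpan (G : DirectedGraph V E) (b : V) (γ : List E) :
    Submodule K (LeavittPathAlgebra K G) :=
  Submodule.span K {x | ∃ (p : FirstPath G b) (n : ℤ), x = firstElem K p * cyclePow K G b γ n}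

theorem pathElem_mul_cyclePow_mem {a b : V} {p : List E} (γ : List E) (hp : G.IsPath a p b)
    (hpb : ∀ e ∈ p, G.s e ≠ b) (n : ℤ) :
    pathElem K G a p * cyclePow K G b γ n ∈ firstSpan K G b γ :=
  Submodule.subset_span ⟨⟨p, ⟨a, hp⟩, hpb⟩, n, by rw [firstElem_eq hp]⟩

variable {b : V} {e₀ : E} {γ : List E}

theorem source_ne_of_nodup (hγ : G.IsPath b (e₀ :: γ) b)
    (hnd : ((e₀ :: γ).map G.s).Nodup) : ∀ e ∈ γ, G.s e ≠ b := by
  intro e he h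
  rw [List.map_cons, List.nodup_cons] at hnd
  exact hnd.1 (List.mem_map.2 ⟨e, he, h.trans hγ.1.symm⟩)

variable (hγ : G.IsPath b (e₀ :: γ) b) (hexit : G.HasNoExit (e₀ :: γ))
  (hnd : ((e₀ :: γ).map G.s).Nodup)

include hγ hexit hnd

/-- Only generators matter. Prefixing an edge `e` to a first path gives a first path unless `e`
starts at `b`; then `e = e₀`, the path is the rest of the cycle, and the full turn is absorbed into
the power. A ghost edge removes the first edge of the path. -/
theorem mul_mem_firstSpan (x : LeavittPathAlgebra K G) {y : LeavittPathAlgebra K G}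
    (hy : y ∈ firstSpan K G b (e₀ :: γ)) : x * y ∈ firstSpan K G b (e₀ :: γ) := by
  have hunit := isCornerUnit_cycle (K := K) hγ hexit
  have hγb := source_ne_of_nodup hγ hnd
  have hγexit : G.HasNoExit γ := fun g hg => hexit g (List.mem_cons_of_mem _ hg)
  have hgen : ∀ x : LeavittPathAlgebra K G, (∀ (p : FirstPath G b) (n : ℤ),
      x * firstElem K p * cyclePow K G b (e₀ :: γ) n ∈ firstSpan K G b (e₀ :: γ)) →
      ∀ y ∈ firstSpan K G b (e₀ :: γ), x * y ∈ firstSpan K G b (e₀ :: γ) := by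
    intro x hx
    have h : firstSpan K G b (e₀ :: γ) ≤
        (firstSpan K G b (e₀ :: γ)).comap (LinearMap.mulLeft K x) := by
      refine Submodule.span_le.2 ?_
      rintro _ ⟨p, n, rfl⟩
      rw [SetLike.mem_coe, Submodule.mem_comap, LinearMap.mulLeft_apply, ← mul_assoc]
      exact hx p n
    exact h
  induction x using induction generalizing y with
  | hv a =>
    refine hgen _ (fun p n => ?_) y hy
    by_cases ha : a = listSource G b p.path
    · subst ha
      rw [firstElem, vertex_mul_pathElem (isPath_listSource p)]
      exact Submodule.subset_span ⟨p, n, rfl⟩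
    · rw [firstElem, vertex_mul_pathElem_of_ne (isPath_listSource p) ha, zero_mul]
      exact zero_mem _
  | he e =>
    refine hgen _ (fun p n => ?_) y hy
    by_cases ha : G.r e = listSource G b p.path
    · have hp := isPath_listSource p
      rw [← ha] at hp
      rw [firstElem, ← ha]
      by_cases hs : G.s e = b
      · obtain rfl : e = e₀ := hexit e₀ List.mem_cons_self e (hs.trans hγ.1.symm)
        have hpγ : p.path = γ := eq_of_hasNoExit hp hγ.2 p.source_ne hγb hγexit
        have hstep : edge K G e * pathElem K G (G.r e) p.path * cyclePow K G b (e :: γ) n =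
            pathElem K G b [] * cyclePow K G b (e :: γ) (n + 1) := by
          rw [hpγ, cyclePow, cornerPow_add_one hunit, pathElem, ← mul_assoc, hunit.left_mul]
          rfl
        rw [hstep]
        exact pathElem_mul_cyclePow_mem (p := []) _ rfl (by simp) _
      · exact pathElem_mul_cyclePow_mem (p := e :: p.path) _ ⟨rfl, hp⟩
          (by simpa [hs] using p.source_ne) n
    · rw [firstElem, ← edge_mul_range, mul_assoc (edge K G e),
        vertex_mul_pathElem_of_ne (isPath_listSource p) ha, mul_zero, zero_mul]
      exact zero_mem _
  | hg e =>
    refine hgen _ (fun p n => ?_) y hy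
    obtain ⟨p, ⟨a, hp⟩, hpb⟩ := p
    rw [firstElem_eq hp]
    cases p with
    | nil =>
      obtain rfl : a = b := hp
      rw [pathElem]
      by_cases hs : G.s e = a
      · obtain rfl : e = e₀ := hexit e₀ List.mem_cons_self e (hs.trans hγ.1.symm)
        have hstep : ghost K G e * vertex K G a * cyclePow K G a (e :: γ) n =
            pathElem K G (G.r e) γ * cyclePow K G a (e :: γ) (n - 1) := by
          -- The path is empty, so one turn is split off from the power to supply the edge that `e*`
          -- cancels.
          have hn : cyclePow K G a (e :: γ) n =
              edge K G e * pathElem K G (G.r e) γ * cyclePow K G a (e :: γ) (n - 1) := by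
            conv_lhs => rw [← sub_add_cancel n 1, cyclePow, cornerPow_add_one hunit]
            rfl
          rw [hn, ← hs, ghost_mul_source, ← mul_assoc, ← mul_assoc, ghost_mul_edge_self,
            vertex_mul_pathElem hγ.2]
        rw [hstep]
        exact pathElem_mul_cyclePow_mem _ hγ.2 hγb _
      · rw [ghost_mul_vertex_of_ne K G hs, zero_mul]
        exact zero_mem _
    | cons f p =>
      rw [pathElem, ← mul_assoc]
      by_cases hef : e = f
      · subst hef
        rw [ghost_mul_edge_self, vertex_mul_pathElem hp.2]
        exact pathElem_mul_cyclePow_mem _ hp.2 (fun g hg => hpb g (List.mem_cons_of_mem _ hg)) n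
      · rw [ghost_mul_edge_of_ne K G hef, zero_mul, zero_mul]
        exact zero_mem _
  | zero => rw [zero_mul]; exact zero_mem _
  | add x x' hx hx' => rw [add_mul]; exact add_mem (hx hy) (hx' hy)
  | smul k x hx => rw [smul_mul_assoc]; exact Submodule.smul_mem _ _ (hx hy)
  | mul x x' hx hx' => rw [mul_assoc]; exact hx (hx' hy)

omit hnd in
theorem adj_cyclePow (n : ℤ) :
    adj (cyclePow K G b (e₀ :: γ) n) = cyclePow K G b (e₀ :: γ) (-n) := by
  have hunit := isCornerUnit_cycle (K := K) hγ hexit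
  induction n using Int.induction_on with
  | zero => exact adj_vertex b
  | succ n ih =>
    rw [cyclePow, cornerPow_add_one hunit, adj_mul, adj_pathElem, neg_add, cornerPow_add hunit,
      cornerPow_neg_one hunit]
    exact congrArg (· * _) ih
  | pred n ih =>
    rw [cyclePow, cornerPow_sub_one hunit, adj_mul, adj_ghostElem, neg_sub', sub_neg_eq_add,
      cornerPow_add hunit, cornerPow_one hunit]
    exact congrArg (· * _) ih

/-- The elements `p γⁿ q*` for first paths `p` and `q` span the algebra. -/
theorem mem_span_firstElem (htop : TwoSidedIdeal.span {vertex K G b} = ⊤)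
    (x : LeavittPathAlgebra K G) : x ∈ Submodule.span K {x | ∃ (p q : FirstPath G b) (n : ℤ),
      x = firstElem K p * cyclePow K G b (e₀ :: γ) n * firstGhost K q} := by
  set N := Submodule.span K {x | ∃ (p q : FirstPath G b) (n : ℤ),
      x = firstElem K p * cyclePow K G b (e₀ :: γ) n * firstGhost K q} with hN
  have hright : ∀ (q : FirstPath G b), ∀ y ∈ firstSpan K G b (e₀ :: γ),
      y * firstGhost K q ∈ N := by
    intro q
    have h : firstSpan K G b (e₀ :: γ) ≤ N.comap (LinearMap.mulRight K (firstGhost K q)) := by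
      refine Submodule.span_le.2 ?_
      rintro _ ⟨p, n, rfl⟩
      exact Submodule.subset_span ⟨p, q, n, rfl⟩
    exact h
  -- The mirror image of `hright`: right multiplication is reduced to `mul_mem_firstSpan` by the
  -- involution, which inverts the powers of the cycle.
  have hleft : ∀ (p : FirstPath G b), ∀ y ∈ firstSpan K G b (e₀ :: γ),
      firstElem K p * adj y ∈ N := by
    intro p
    have h : firstSpan K G b (e₀ :: γ) ≤
        N.comap (LinearMap.mulLeft K (firstElem K p) ∘ₗ adj) := by
      refine Submodule.span_le.2 ?_
      rintro _ ⟨q, n, rfl⟩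
      refine Submodule.subset_span ⟨p, q, -n, ?_⟩
      rw [LinearMap.comp_apply, LinearMap.mulLeft_apply, adj_mul, adj_cyclePow hγ hexit, firstElem,
        firstElem, adj_pathElem, mul_assoc, firstGhost]
    exact h
  have hmulleft : ∀ x y, y ∈ N → x * y ∈ N := by
    intro x
    have h : N ≤ N.comap (LinearMap.mulLeft K x) := by
      refine Submodule.span_le.2 ?_
      rintro _ ⟨p, q, n, rfl⟩
      rw [SetLike.mem_coe, Submodule.mem_comap, LinearMap.mulLeft_apply, ← mul_assoc]
      exact hright q _ (mul_mem_firstSpan hγ hexit hnd x (Submodule.subset_span ⟨p, n, rfl⟩))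
    exact h
  have hmulright : ∀ x y, y ∈ N → y * x ∈ N := by
    intro x
    have h : N ≤ N.comap (LinearMap.mulRight K x) := by
      refine Submodule.span_le.2 ?_
      rintro _ ⟨p, q, n, rfl⟩
      have h := hleft p _ (mul_mem_firstSpan hγ hexit hnd (adj x)
        (Submodule.subset_span ⟨q, -n, rfl⟩))
      rw [adj_mul, adj_adj, adj_mul, adj_cyclePow hγ hexit, neg_neg, firstElem, firstElem,
        adj_pathElem] at h
      rw [SetLike.mem_coe, Submodule.mem_comap, LinearMap.mulRight_apply, mul_assoc, mul_assoc]
      rwa [mul_assoc] at h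
    exact h
  -- `N` is a two-sided ideal and contains `b`, which is the element with both first paths empty and
  -- exponent zero.
  have hle : TwoSidedIdeal.span {vertex K G b} ≤ TwoSidedIdeal.mk' (N : Set _) (zero_mem _)
      (fun hx hy => add_mem hx hy) (fun hx => neg_mem hx) (fun hy => hmulleft _ _ hy)
      (fun hx => hmulright _ _ hx) := by
    rw [TwoSidedIdeal.span_le, Set.singleton_subset_iff, SetLike.mem_coe, TwoSidedIdeal.mem_mk']
    refine Submodule.subset_span
      ⟨⟨[], ⟨b, rfl⟩, by simp⟩, ⟨[], ⟨b, rfl⟩, by simp⟩, 0, ?_⟩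
    have h0 : cyclePow K G b (e₀ :: γ) 0 = vertex K G b := rfl
    rw [h0, firstElem_eq (p := ⟨[], _, _⟩) rfl, firstGhost_eq (p := ⟨[], _, _⟩) rfl, pathElem, ghostElem,
      vertex_mul_self, vertex_mul_self]
  rw [htop] at hle
  exact (TwoSidedIdeal.mem_mk' _ _ _ _ _ _ _).1 (hle (x := x) trivial)

/-- If a cycle without exits generates the algebra as an ideal, the algebra is a matrix algebra over
the Laurent polynomials. -/
theorem exists_linearEquiv_finMatrix (hrow : G.RowFinite)
    (htop : TwoSidedIdeal.span {vertex K G b} = ⊤) :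
    ∃ e : FinMatrix (FirstPath G b) (LaurentPolynomial K) ≃ₗ[K] LeavittPathAlgebra K G,
      ∀ M N, e (M * N) = e M * e N := by
  set θ := cornerLift (isCornerUnit_cycle (K := K) hγ hexit) K with hθ
  have h₁ : ∀ p : FirstPath G b, firstGhost K p * firstElem K p = θ 1 := by
    intro p
    rw [firstGhost_mul_firstElem_self, hθ, cornerLift_one]
  have h₂ := firstGhost_mul_firstElem_of_ne (K := K) (G := G) (b := b)
  have hinj := FinMatrix.unitsLift_injective _ _ θ h₁ h₂
    (cornerLift_injective hrow hγ (by simp) hexit)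
  have hsurj : Function.Surjective (FinMatrix.unitsLift (firstElem K (b := b)) (firstGhost K) θ) := by
    rw [← LinearMap.range_eq_top, eq_top_iff]
    refine fun x _ => Submodule.span_le.2 ?_ (mem_span_firstElem hγ hexit hnd htop x)
    rintro _ ⟨p, q, n, rfl⟩
    -- The spanning element is the image of the matrix with the monomial of exponent `n` as its only
    -- entry.
    refine ⟨FinMatrix.single p q (AddMonoidAlgebra.single n 1), ?_⟩
    rw [FinMatrix.unitsLift_single, hθ, cornerLift_single, one_smul, cyclePow]
  exact ⟨LinearEquiv.ofBijective _ ⟨hinj, hsurj⟩, FinMatrix.unitsLift_mul _ _ θ h₁ h₂⟩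

end

end Span

end CycleCorner

end LeavittPathAlgebra

/-! ### The main theorem -/

theorem mainTheorem3 {K : Type w} [Field K] {V : Type u} {E : Type v} (G : DirectedGraph V E)
    (hrow : G.RowFinite) (hgraded : LeavittPathAlgebra.IsGradedSimple K G)
    (hsimple : ¬ IsSimpleRing (LeavittPathAlgebra K G)) :
    G.IsComet ∧
      (∃ (Λ : Type v) (φ : LeavittPathAlgebra K G →ₙₐ[K] FinMatrix Λ (LaurentPolynomial K)),
        Nonempty Λ ∧ Function.Bijective φ) ∧
      Nonempty (centroid K (LeavittPathAlgebra K G) ≃ₐ[K] LaurentPolynomial K) := by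
  obtain ⟨b, c, hc, hcyc, hexit⟩ := DirectedGraph.exists_isCycle_hasNoExit
    (LeavittPathAlgebra.exists_closed_hasNoExit hrow hgraded hsimple)
  have hleads := LeavittPathAlgebra.eq_univ_of_isHereditarySaturated hrow hgraded
    (DirectedGraph.isHereditarySaturated_leadsTo hc hcyc.1 hexit) ⟨b, .base⟩
  refine ⟨DirectedGraph.isComet_of_leadsTo hc hcyc hexit hleads, ?_⟩
  obtain ⟨e₀, γ, rfl⟩ := List.exists_cons_of_ne_nil hcyc.1
  obtain ⟨e, he⟩ := LeavittPathAlgebra.exists_linearEquiv_finMatrix hc hexit hcyc.2.2 hrow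
    (LeavittPathAlgebra.span_vertex_eq_top (K := K) hrow hgraded b)
  have hne : Nonempty (LeavittPathAlgebra.FirstPath G b) := ⟨⟨[], ⟨b, rfl⟩, by simp⟩⟩
  refine ⟨⟨LeavittPathAlgebra.FirstPath G b, { e.symm with
    map_mul' := fun x y => e.injective (by simp [he])
    map_zero' := map_zero e.symm }, hne, e.symm.bijective⟩, ?_⟩
  obtain ⟨ε⟩ := nonempty_centroid_algEquiv e he
  exact ⟨ε.symm.trans (AlgEquiv.ofBijective _ FinMatrix.scalarCentroid_bijective).symm⟩
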